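/- Let $(E,C)$ be a finite bipartite separated graph: $E$ is a finite directed graph with vertex set $E^0=E^{0,0}\sqcup E^{0,1}$ in which every edge $x\in E^1$ has source $s(x)\in E^{0,1}$ and range $r(x)\in E^{0,0}$, with $r(E^1)=E^{0,0}$ and $s(E^1)=E^{0,1}$, and for each $v\in E^{0,0}$, $C_v$ is a partition of $r^{-1}(v)$ into nonempty subsets. **Dynamical systems.** An $(E,C)$-dynamical system $(\Omega,\theta)$ consists of a compact Hausdorff space $\Omega$, clopen subsets $\Omega_v$ ($v\in E^0$) with $\Omega=\bigsqcup_{v\in E^0}\Omega_v$, clopen subsets $H_x\subseteq\Omega_{r(x)}$ ($x\in E^1$) with $\Omega_v=\bigsqcup_{x\in X}H_x$ for all $v\in E^{0,0}$ and $X\in C_v$, and homeomorphisms $\theta_x\colon\Omega_{s(x)}\to H_x$ ($x\in E^1$). A map $f\colon\Omega\to\Omega'$ between two such systems is equivariant if $f(\Omega_v)\subseteq\Omega'_v$ for all $v\in E^0$, $f(H_x)\subseteq H'_x$ for all $x\in E^1$, and $f(\theta_x(y))=\theta'_x(f(y))$ for all $x\in E^1$ and $y\in\Omega_{s(x)}$.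 **The system $(\Omega(E,C),\alpha^*)$.** Let $L(E,C)$ be the complex $*$-algebra with generators $v\in E^0$, $x\in E^1$ and relations $vv'=\delta_{v,v'}v$, $v=v^*$; $r(x)x=xs(x)=x$; $x^*y=\delta_{x,y}s(x)$ for $x,y\in X\in C_v$; $v=\sum_{x\in X}xx^*$ for $X\in C_v$ (here $v\in E^{0,0}$). Put $(E_0,C^0)=(E,C)$, and define $(E_{n+1},C^{n+1})$ from $(E_n,C^n)$ as follows: $E_{n+1}^{0,0}=E_n^{0,1}$; $E_{n+1}^{0,1}$ consists of the symbols $v(x_1,\dots,x_k)$ with $u\in E_n^{0,0}$, $C^n_u=\{X_1,\dots,X_k\}$ and $x_i\in X_i$; for each such symbol and each $i$ there is one edge $\alpha^{x_i}(x_1,\dots,\widehat{x_i},\dots,x_k)$ with source $v(x_1,\dots,x_k)$ and range $s(x_i)$; and $C^{n+1}_w$ consists of the sets $X(x)=\{\alpha^{x}(\dots)\}$, one for each $x\in E_n^1$ with $s(x)=w$. Let $\phi_n\colon L(E_n,C^n)\to L(E_{n+1},C^{n+1})$ be the $*$-homomorphism with $\phi_n(u)=\sum v(x_1,\dots,x_k)$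 (sum over all $(x_i)\in\prod X_i$, $C^n_u=\{X_1,\dots,X_k\}$) for $u\in E_n^{0,0}$, $\phi_n(w)=w$ for $w\in E_n^{0,1}$, and $\phi_n(x)=\sum_{z\in X(x)}z^*$ for $x\in E_n^1$. Let $L^{\rm ab}(E,C)=\varinjlim_n L(E_n,C^n)$, let $\underline x$ be the image of $x\in E^1$ in it, and let $B_\infty\subseteq L^{\rm ab}(E,C)$ be the union of the images of the commutative subalgebras $B_n\subseteq L(E_n,C^n)$ generated by $E_n^0$; it is commutative. Then $\Omega(E,C)$ is the spectrum of $B_\infty$ (equivalently, of its C*-completion), i.e. its set of characters with the topology of pointwise convergence. Put $\Omega(E,C)_v=\{\chi:\chi(v)=1\}$ for $v\in E^0$ and $H_x=\{\chi:\chi(\underline x\,\underline x^*)=1\}$ for $x\in E^1$, and let $\alpha_x^*\colon\Omega(E,C)_{s(x)}\to H_x$ be the map dual to conjugation $\alpha_x\colon \underline x^*\underline x B_\infty\to\underline x\,\underline x^*B_\infty$, $b\mapsto \underline x b\underline x^*$, that is, $\alpha_x^*(\chi)(b)=\chi(\underline x^*b\,\underline x)$. **Statement.** $(\Omega(E,C),\alpha^*)$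 is the universal $(E,C)$-dynamical system: it is an $(E,C)$-dynamical system, and for every $(E,C)$-dynamical system $(\Omega,\theta)$ there is a unique continuous equivariant map $\Omega\to\Omega(E,C)$. -/

import Mathlib

universe u w

noncomputable section

/-- A finite bipartite separated graph `(E, C)`. The vertex set is the disjoint union of `V0`
(the set `E^{0,0}`) and `V1` (the set `E^{0,1}`); every edge goes from its source `s x` in `V1` to
its range `r x` in `V0`; every vertex of `V0` is the range of an edge and every vertex of `V1` is
the source of an edge. For each vertex `v` of `V0`, `C v` is a partition of `r⁻¹(v)` into nonempty
subsets. (At the vertices of `V1`, which receive no edges, the partition is empty.) -/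
structure BipSepGraph : Type (u + 1) where
  V0 : Type u
  V1 : Type u
  Edge : Type u
  finite_V0 : Finite V0
  finite_V1 : Finite V1
  finite_Edge : Finite Edge
  r : Edge → V0
  s : Edge → V1
  r_surj : Function.Surjective r
  s_surj : Function.Surjective s
  C : V0 → Set (Set Edge)
  C_subset : ∀ v, ∀ X ∈ C v, ∀ x ∈ X, r x = v
  C_nonempty : ∀ v, ∀ X ∈ C v, X.Nonempty
  C_disjoint : ∀ v, ∀ X ∈ C v, ∀ Y ∈ C v, ∀ x, x ∈ X → x ∈ Y → X = Y
  C_cover : ∀ x, ∃ X ∈ C (r x), x ∈ X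

namespace BipSepGraph

instance (E : BipSepGraph.{u}) : Finite E.V0 := E.finite_V0
instance (E : BipSepGraph.{u}) : Finite E.V1 := E.finite_V1
instance (E : BipSepGraph.{u}) : Finite E.Edge := E.finite_Edge
instance (E : BipSepGraph.{u}) : Fintype E.V0 := Fintype.ofFinite _
instance (E : BipSepGraph.{u}) : Fintype E.V1 := Fintype.ofFinite _
instance (E : BipSepGraph.{u}) : Fintype E.Edge := Fintype.ofFinite _

/-- The set `E^0` of all vertices. -/
abbrev Vert (E : BipSepGraph.{u}) : Type u := E.V0 ⊕ E.V1

/-! ### The multiresolution and the canonical sequence -/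

/-- The new vertices `v(x_1, …, x_k)`: a vertex `u` in `E^{0,0}` together with the choice of one
edge in each of the sets `X_1, …, X_k` of the partition `C_u`. -/
def NewVert (E : BipSepGraph.{u}) : Type u :=
  Σ u : E.V0, {c : E.C u → E.Edge // ∀ X : E.C u, c X ∈ X.1}

/-- The new edges `α^{x_i}(x_1, …, x_{i-1}, x_{i+1}, …, x_k)`: they correspond to a new vertex
`v(x_1, …, x_k)` (the source of the edge) together with one of the sets `X_i` in `C_u`. -/
def NewEdge (E : BipSepGraph.{u}) : Type u :=
  Σ p : E.NewVert, E.C p.1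

/-- The edge `x_i` attached to the new edge `α^{x_i}(x_1, …, x_{i-1}, x_{i+1}, …, x_k)`. -/
def NewEdge.base {E : BipSepGraph.{u}} (q : E.NewEdge) : E.Edge := q.1.2.1 q.2

theorem exists_choice (E : BipSepGraph.{u}) (x : E.Edge) :
    ∃ q : E.NewEdge, q.base = x := by
  classical
  obtain ⟨X, hX, hx⟩ := E.C_cover x
  refine ⟨⟨⟨E.r x, ⟨fun Y => if Y.1 = X then x else (E.C_nonempty _ Y.1 Y.2).choose, ?_⟩⟩,
    ⟨X, hX⟩⟩, ?_⟩
  · intro Y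
    by_cases h : Y.1 = X
    · simp only [h, if_true]; exact hx
    · simp only [h, if_false]; exact (E.C_nonempty _ Y.1 Y.2).choose_spec
  · simp [NewEdge.base]

instance (E : BipSepGraph.{u}) : Finite E.NewVert := by
  unfold NewVert; infer_instance

instance (E : BipSepGraph.{u}) : Finite E.NewEdge := by
  unfold NewEdge; infer_instance

/-- The graph `(E_{n+1}, C^{n+1})` obtained from `(E_n, C^n)`: the part of the multiresolution of
`(E_n, C^n)` at the set `E_n^{0,0}` that consists of the new edges, with their ranges (the vertices
in `E_n^{0,1}`) and their sources (the new vertices). The range of `α^x(…)` is `s(x)`, and the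
partition at `w` consists of the sets `X(x)`, for the edges `x` with `s(x) = w`. -/
def next (E : BipSepGraph.{u}) : BipSepGraph.{u} where
  V0 := E.V1
  V1 := E.NewVert
  Edge := E.NewEdge
  finite_V0 := inferInstance
  finite_V1 := inferInstance
  finite_Edge := inferInstance
  r q := E.s q.base
  s q := q.1
  r_surj w := by
    obtain ⟨x, rfl⟩ := E.s_surj w
    obtain ⟨q, rfl⟩ := E.exists_choice x
    exact ⟨q, rfl⟩
  s_surj p := by
    obtain ⟨x, hx⟩ := E.r_surj p.1
    obtain ⟨X, hX, -⟩ := E.C_cover x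
    exact ⟨⟨p, ⟨X, hx ▸ hX⟩⟩, rfl⟩
  C w := {Y | ∃ x, E.s x = w ∧ Y = {q : E.NewEdge | q.base = x}}
  C_subset := by
    rintro _ _ ⟨x, rfl, rfl⟩ q rfl
    rfl
  C_nonempty := by
    rintro _ _ ⟨x, rfl, rfl⟩
    exact E.exists_choice x
  C_disjoint := by
    rintro _ _ ⟨x, rfl, rfl⟩ _ ⟨y, -, rfl⟩ q rfl rfl
    rfl
  C_cover q := ⟨_, ⟨q.base, rfl, rfl⟩, rfl⟩

/-- The vertex `w` in `E_n^{0,1}` seen as a vertex in `E_{n+1}^{0,0}`. -/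
def up (E : BipSepGraph.{u}) (w : E.V1) : E.next.V0 := w

/-- The vertex `u` from which a new vertex `v(x_1, …, x_k)` comes. -/
def root (E : BipSepGraph.{u}) (p : E.next.V1) : E.V0 := Sigma.fst p

/-- The edge `x` from which a new edge `α^x(…)` comes. -/
def base (E : BipSepGraph.{u}) (q : E.next.Edge) : E.Edge := NewEdge.base q

/-- The set `X(x)` of all the new edges `α^x(…)`. -/
def newGroup (E : BipSepGraph.{u}) (x : E.Edge) : Set E.next.Edge := {q | E.base q = x}

/-- The canonical sequence `(E_n, C^n)` of finite bipartite separated graphs. -/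
def seq (E : BipSepGraph.{u}) : ℕ → BipSepGraph.{u}
  | 0 => E
  | n + 1 => (seq E n).next

/-! ### Leavitt path algebras of separated graphs -/

/-- The generators of the Leavitt path algebra: the vertices, the edges `x` and the
adjoints `x^*` of the edges. -/
inductive Gen (E : BipSepGraph.{u}) : Type u
  | vert : E.Vert → Gen E
  | edge : E.Edge → Gen E
  | ghost : E.Edge → Gen E

/-- The generators as elements of the free algebra. -/
def gen (E : BipSepGraph.{u}) (g : Gen E) : FreeAlgebra ℂ (Gen E) := FreeAlgebra.ι ℂ g

open Gen in
open Classical in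
/-- The defining relations (V), (E), (SCK1), (SCK2) of the Leavitt path algebra, together with the
adjoints of the relations (E). The graph is finite, so `L(E, C)` is unital, and its
unit is the sum of all the vertices. -/
inductive LeavittRel (E : BipSepGraph.{u}) :
    FreeAlgebra ℂ (Gen E) → FreeAlgebra ℂ (Gen E) → Prop
  | vert_mul_self (v : E.Vert) : LeavittRel E (gen E (vert v) * gen E (vert v)) (gen E (vert v))
  | vert_mul_vert (v w : E.Vert) (h : v ≠ w) : LeavittRel E (gen E (vert v) * gen E (vert w)) 0
  | sum_vert : LeavittRel E (∑ v : E.Vert, gen E (vert v)) 1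
  | range_mul_edge (x : E.Edge) :
      LeavittRel E (gen E (vert (.inl (E.r x))) * gen E (edge x)) (gen E (edge x))
  | edge_mul_source (x : E.Edge) :
      LeavittRel E (gen E (edge x) * gen E (vert (.inr (E.s x)))) (gen E (edge x))
  | ghost_mul_range (x : E.Edge) :
      LeavittRel E (gen E (ghost x) * gen E (vert (.inl (E.r x)))) (gen E (ghost x))
  | source_mul_ghost (x : E.Edge) :
      LeavittRel E (gen E (vert (.inr (E.s x))) * gen E (ghost x)) (gen E (ghost x))
  | ghost_mul_edge_self (x : E.Edge) :
      LeavittRel E (gen E (ghost x) * gen E (edge x)) (gen E (vert (.inr (E.s x))))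
  | ghost_mul_edge (v : E.V0) (X : Set E.Edge) (hX : X ∈ E.C v) (x y : E.Edge)
      (hx : x ∈ X) (hy : y ∈ X) (h : x ≠ y) : LeavittRel E (gen E (ghost x) * gen E (edge y)) 0
  | sum_edge_mul_ghost (v : E.V0) (X : Set E.Edge) (hX : X ∈ E.C v) :
      LeavittRel E (∑ x with x ∈ X, gen E (edge x) * gen E (ghost x)) (gen E (vert (.inl v)))

/-- The Leavitt path algebra `L(E, C)` over the complex numbers. -/
def LPA (E : BipSepGraph.{u}) : Type u := RingQuot (LeavittRel E)

instance (E : BipSepGraph.{u}) : Ring (LPA E) := inferInstanceAs (Ring (RingQuot (LeavittRel E)))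
instance (E : BipSepGraph.{u}) : Algebra ℂ (LPA E) :=
  inferInstanceAs (Algebra ℂ (RingQuot (LeavittRel E)))

/-- The quotient map from the free algebra onto the Leavitt path algebra. -/
def toLPA (E : BipSepGraph.{u}) : FreeAlgebra ℂ (Gen E) →ₐ[ℂ] LPA E :=
  RingQuot.mkAlgHom ℂ (LeavittRel E)

/-- The vertex `v` as an element of `L(E, C)`. -/
def vtx (E : BipSepGraph.{u}) (v : E.Vert) : LPA E := E.toLPA (E.gen (.vert v))

/-- The edge `x` as an element of `L(E, C)`. -/
def edg (E : BipSepGraph.{u}) (x : E.Edge) : LPA E := E.toLPA (E.gen (.edge x))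

/-- The adjoint `x^*` of the edge `x`, as an element of `L(E, C)`. -/
def gho (E : BipSepGraph.{u}) (x : E.Edge) : LPA E := E.toLPA (E.gen (.ghost x))

section relations

variable (E : BipSepGraph.{u})

theorem toLPA_rel {a b : FreeAlgebra ℂ (Gen E)} (h : LeavittRel E a b) :
    E.toLPA a = E.toLPA b := RingQuot.mkAlgHom_rel ℂ h

theorem vtx_mul_self (v : E.Vert) : E.vtx v * E.vtx v = E.vtx v := by
  simpa [vtx] using E.toLPA_rel (.vert_mul_self v)

theorem vtx_mul_vtx {v w : E.Vert} (h : v ≠ w) : E.vtx v * E.vtx w = 0 := by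
  simpa [vtx] using E.toLPA_rel (.vert_mul_vert v w h)

theorem sum_vtx : ∑ v : E.Vert, E.vtx v = 1 := by
  simpa [vtx] using E.toLPA_rel .sum_vert

theorem range_mul_edg (x : E.Edge) : E.vtx (.inl (E.r x)) * E.edg x = E.edg x := by
  simpa [vtx, edg] using E.toLPA_rel (.range_mul_edge x)

theorem edg_mul_source (x : E.Edge) : E.edg x * E.vtx (.inr (E.s x)) = E.edg x := by
  simpa [vtx, edg] using E.toLPA_rel (.edge_mul_source x)

theorem gho_mul_range (x : E.Edge) : E.gho x * E.vtx (.inl (E.r x)) = E.gho x := by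
  simpa [vtx, gho] using E.toLPA_rel (.ghost_mul_range x)

theorem source_mul_gho (x : E.Edge) : E.vtx (.inr (E.s x)) * E.gho x = E.gho x := by
  simpa [vtx, gho] using E.toLPA_rel (.source_mul_ghost x)

theorem gho_mul_edg_self (x : E.Edge) : E.gho x * E.edg x = E.vtx (.inr (E.s x)) := by
  simpa [vtx, gho, edg] using E.toLPA_rel (.ghost_mul_edge_self x)

theorem gho_mul_edg {v : E.V0} {X : Set E.Edge} (hX : X ∈ E.C v) {x y : E.Edge}
    (hx : x ∈ X) (hy : y ∈ X) (h : x ≠ y) : E.gho x * E.edg y = 0 := by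
  simpa [gho, edg] using E.toLPA_rel (.ghost_mul_edge v X hX x y hx hy h)

open Classical in
theorem sum_edg_mul_gho {v : E.V0} {X : Set E.Edge} (hX : X ∈ E.C v) :
    ∑ x with x ∈ X, E.edg x * E.gho x = E.vtx (.inl v) := by
  simpa [gho, edg, vtx] using E.toLPA_rel (.sum_edge_mul_ghost v X hX)

end relations

/-! ### The connecting maps and the direct limit -/

open Classical in
/-- The values on the generators of the connecting map `φ : L(E_n, C^n) → L(E_{n+1}, C^{n+1})`:
a vertex `u` in `E_n^{0,0}` goes to the sum of all `v(x_1, …, x_k)` with `x_i ∈ X_i`,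
where `C_u = {X_1, …, X_k}`, a vertex in `E_n^{0,1}` goes to itself, and an edge `x`
goes to the sum of all the elements `(α^x(…))^*`. -/
def phiGen (E : BipSepGraph.{u}) : Gen E → LPA E.next
  | .vert (.inl v) => ∑ p with E.root p = v, E.next.vtx (.inr p)
  | .vert (.inr w) => E.next.vtx (.inl (E.up w))
  | .edge x => ∑ q with q ∈ E.newGroup x, E.next.gho q
  | .ghost x => ∑ q with q ∈ E.newGroup x, E.next.edg q

theorem newGroup_mem (E : BipSepGraph.{u}) (x : E.Edge) :
    E.newGroup x ∈ E.next.C (E.up (E.s x)) := ⟨x, rfl, rfl⟩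

theorem mem_newGroup {E : BipSepGraph.{u}} {x : E.Edge} {q : E.next.Edge} :
    q ∈ E.newGroup x ↔ E.base q = x := Iff.rfl

theorem next_r (E : BipSepGraph.{u}) (q : E.next.Edge) :
    E.next.r q = E.up (E.s (E.base q)) := rfl

theorem up_injective (E : BipSepGraph.{u}) : Function.Injective E.up := fun _ _ h => h

theorem root_s (E : BipSepGraph.{u}) (q : E.next.Edge) :
    E.root (E.next.s q) = E.r (E.base q) :=
  (E.C_subset _ _ (Sigma.snd q).2 _ ((Sigma.fst q).2.2 (Sigma.snd q))).symm

/-- A new edge is determined by its source and by the set of the partition it comes from. -/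
theorem newEdge_eq (E : BipSepGraph.{u}) {v : E.V0} {X : Set E.Edge} (hX : X ∈ E.C v)
    {q q' : E.next.Edge} (hq : E.base q ∈ X) (hq' : E.base q' ∈ X)
    (h : E.next.s q = E.next.s q') : q = q' := by
  obtain ⟨p, Y⟩ := q
  obtain ⟨p', Y'⟩ := q'
  obtain rfl : p = p' := h
  have hb : p.2.1 Y ∈ X := hq
  have hb' : p.2.1 Y' ∈ X := hq'
  have hp : p.1 = v := by
    rw [← E.C_subset v X hX _ hb]
    exact (E.C_subset _ _ Y.2 _ (p.2.2 Y)).symm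
  have hX' : X ∈ E.C p.1 := hp ▸ hX
  have h1 : Y.1 = X := E.C_disjoint p.1 _ Y.2 _ hX' _ (p.2.2 Y) hb
  have h2 : Y'.1 = X := E.C_disjoint p.1 _ Y'.2 _ hX' _ (p.2.2 Y') hb'
  have : Y = Y' := Subtype.ext (h1.trans h2.symm)
  rw [this]

/-- Every new vertex `v(x_1, …, x_k)` is the source of an edge coming from an edge in `X_i`. -/
theorem exists_newEdge (E : BipSepGraph.{u}) {v : E.V0} {X : Set E.Edge} (hX : X ∈ E.C v)
    (p : E.next.V1) (hp : E.root p = v) : ∃ q, E.next.s q = p ∧ E.base q ∈ X := by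
  subst hp
  exact ⟨⟨p, ⟨X, hX⟩⟩, rfl, (Sigma.snd p).2 ⟨X, hX⟩⟩

open Classical in
theorem phi_edge_mul_ghost (E : BipSepGraph.{u}) (x : E.Edge) :
    E.phiGen (.edge x) * E.phiGen (.ghost x) =
      ∑ q with q ∈ E.newGroup x, E.next.vtx (.inr (E.next.s q)) := by
  simp only [phiGen, Finset.sum_mul, Finset.mul_sum]
  refine Finset.sum_congr rfl fun q hq => ?_
  rw [Finset.sum_eq_single_of_mem q hq]
  · exact E.next.gho_mul_edg_self q
  · intro q' hq' hne
    exact E.next.gho_mul_edg (E.newGroup_mem x) (by simpa using hq') (by simpa using hq) hne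

theorem edg_mul_gho_of_ne (E : BipSepGraph.{u}) {x y : E.Edge} (h : E.s x ≠ E.s y) :
    E.edg x * E.gho y = 0 := by
  rw [← E.edg_mul_source x, ← E.source_mul_gho y, mul_assoc, ← mul_assoc (E.vtx _) (E.vtx _),
    E.vtx_mul_vtx (by simpa using h)]
  simp

theorem sum_vtx' (E : BipSepGraph.{u}) :
    ∑ v, E.vtx (.inl v) + ∑ w, E.vtx (.inr w) = 1 := by
  rw [← E.sum_vtx, Fintype.sum_sum_type]

theorem phi_respects (E : BipSepGraph.{u}) ⦃a b : FreeAlgebra ℂ (Gen E)⦄ (h : LeavittRel E a b) :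
    FreeAlgebra.lift ℂ E.phiGen a = FreeAlgebra.lift ℂ E.phiGen b := by
  classical
  induction h with
  | vert_mul_self v =>
    rcases v with v | w
    · simp only [gen, map_mul, FreeAlgebra.lift_ι_apply, phiGen, Finset.sum_mul, Finset.mul_sum]
      refine Finset.sum_congr rfl fun p hp => ?_
      rw [Finset.sum_eq_single_of_mem p hp, vtx_mul_self]
      intro q _ hne
      exact E.next.vtx_mul_vtx (by simpa using hne)
    · simp only [gen, map_mul, FreeAlgebra.lift_ι_apply, phiGen, vtx_mul_self]
  | vert_mul_vert v w hne =>
    rcases v with v | v <;> rcases w with w | w <;>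
      simp only [gen, map_mul, FreeAlgebra.lift_ι_apply, phiGen, Finset.sum_mul, Finset.mul_sum,
        map_zero]
    · refine Finset.sum_eq_zero fun p hp => Finset.sum_eq_zero fun q hq => ?_
      refine E.next.vtx_mul_vtx fun h => hne ?_
      simp only [Sum.inr.injEq] at h
      simp only [Finset.mem_filter] at hp hq
      rw [← hp.2, ← hq.2, h]
    · refine Finset.sum_eq_zero fun p hp => E.next.vtx_mul_vtx (by simp)
    · refine Finset.sum_eq_zero fun p hp => E.next.vtx_mul_vtx (by simp)
    · refine E.next.vtx_mul_vtx fun h => hne ?_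
      rw [E.up_injective (Sum.inl_injective h)]
  | sum_vert =>
    rw [Fintype.sum_sum_type]
    simp only [gen, map_add, map_sum, map_one, FreeAlgebra.lift_ι_apply, phiGen]
    rw [Finset.sum_fiberwise Finset.univ E.root, add_comm, ← E.next.sum_vtx']
    rfl
  | range_mul_edge x =>
    simp only [gen, map_mul, FreeAlgebra.lift_ι_apply, phiGen, Finset.mul_sum, Finset.sum_mul]
    refine Finset.sum_congr rfl fun q hq => ?_
    have hq' : E.base q = x := by simpa [mem_newGroup] using hq
    rw [Finset.sum_eq_single_of_mem (E.next.s q)]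
    · exact E.next.source_mul_gho q
    · simpa [← hq'] using E.root_s q
    · intro p _ hne
      rw [← E.next.source_mul_gho q, ← mul_assoc, E.next.vtx_mul_vtx (by simpa using hne), zero_mul]
  | edge_mul_source x =>
    simp only [gen, map_mul, FreeAlgebra.lift_ι_apply, phiGen, Finset.sum_mul]
    refine Finset.sum_congr rfl fun q hq => ?_
    have hq' : E.base q = x := by simpa [mem_newGroup] using hq
    rw [← hq', ← next_r, E.next.gho_mul_range q]
  | ghost_mul_range x =>
    simp only [gen, map_mul, FreeAlgebra.lift_ι_apply, phiGen, Finset.sum_mul]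
    refine Finset.sum_congr rfl fun q hq => ?_
    have hq' : E.base q = x := by simpa [mem_newGroup] using hq
    rw [Finset.mul_sum, Finset.sum_eq_single_of_mem (E.next.s q)]
    · exact E.next.edg_mul_source q
    · simpa [← hq'] using E.root_s q
    · intro p _ hne
      rw [← E.next.edg_mul_source q, mul_assoc, E.next.vtx_mul_vtx (by simpa using hne.symm),
        mul_zero]
  | source_mul_ghost x =>
    simp only [gen, map_mul, FreeAlgebra.lift_ι_apply, phiGen, Finset.mul_sum]
    refine Finset.sum_congr rfl fun q hq => ?_
    have hq' : E.base q = x := by simpa [mem_newGroup] using hq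
    rw [← hq', ← next_r, E.next.range_mul_edg q]
  | ghost_mul_edge_self x =>
    simp only [gen, map_mul, FreeAlgebra.lift_ι_apply]
    obtain ⟨X, hX, hx⟩ := E.C_cover x
    simp only [phiGen]
    rw [← E.next.sum_edg_mul_gho (E.newGroup_mem x)]
    simp only [Finset.sum_mul, Finset.mul_sum]
    refine Finset.sum_congr rfl fun q hq => ?_
    rw [Finset.sum_eq_single_of_mem q hq]
    intro q' hq' hne
    refine E.next.edg_mul_gho_of_ne fun h => hne ?_
    simp only [Finset.mem_filter, Finset.mem_univ, true_and, mem_newGroup] at hq hq'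
    exact (E.newEdge_eq hX (by rw [hq']; exact hx) (by rw [hq]; exact hx) h)
  | ghost_mul_edge v X hX x y hx hy hne =>
    simp only [gen, map_mul, FreeAlgebra.lift_ι_apply, phiGen, Finset.mul_sum, Finset.sum_mul,
      map_zero]
    refine Finset.sum_eq_zero fun q hq => Finset.sum_eq_zero fun q' hq' => ?_
    refine E.next.edg_mul_gho_of_ne fun h => hne ?_
    simp only [Finset.mem_filter, Finset.mem_univ, true_and, mem_newGroup] at hq hq'
    rw [← hq, ← hq', E.newEdge_eq hX (hq ▸ hy) (hq' ▸ hx) h.symm]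
  | sum_edge_mul_ghost v X hX =>
    simp only [gen, map_mul, map_sum, FreeAlgebra.lift_ι_apply, phi_edge_mul_ghost]
    simp only [phiGen]
    rw [Finset.sum_sigma']
    refine Finset.sum_bij (fun z _ => E.next.s z.2) ?_ ?_ ?_ ?_
    · rintro ⟨x, q⟩ h
      simp only [Finset.mem_sigma, Finset.mem_filter, Finset.mem_univ, true_and,
        mem_newGroup] at h ⊢
      rw [E.root_s, h.2, E.C_subset v X hX x h.1]
    · rintro ⟨x, q⟩ h ⟨x', q'⟩ h' heq
      simp only [Finset.mem_sigma, Finset.mem_filter, Finset.mem_univ, true_and,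
        mem_newGroup] at h h'
      obtain rfl := E.newEdge_eq hX (h.2 ▸ h.1) (h'.2 ▸ h'.1) heq
      rw [← h.2, ← h'.2]
    · intro p hp
      obtain ⟨q, hq, hqX⟩ := E.exists_newEdge hX p (by simpa using hp)
      exact ⟨⟨E.base q, q⟩, by simpa [mem_newGroup] using hqX, hq⟩
    · intro _ _
      rfl

/-- The connecting map `φ : L(E_n, C^n) → L(E_{n+1}, C^{n+1})`. -/
def phi (E : BipSepGraph.{u}) : LPA E →ₐ[ℂ] LPA E.next :=
  RingQuot.liftAlgHom ℂ ⟨FreeAlgebra.lift ℂ E.phiGen, E.phi_respects⟩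

theorem phi_toLPA_gen (E : BipSepGraph.{u}) (g : Gen E) :
    E.phi (E.toLPA (E.gen g)) = E.phiGen g := by
  refine (RingQuot.liftAlgHom_mkAlgHom_apply ℂ (FreeAlgebra.lift ℂ E.phiGen) E.phi_respects
    (E.gen g)).trans (FreeAlgebra.lift_ι_apply _ _)

open Classical in
theorem phi_vtx_inl (E : BipSepGraph.{u}) (v : E.V0) :
    E.phi (E.vtx (.inl v)) = ∑ p with E.root p = v, E.next.vtx (.inr p) :=
  E.phi_toLPA_gen _

theorem phi_vtx_inr (E : BipSepGraph.{u}) (w : E.V1) :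
    E.phi (E.vtx (.inr w)) = E.next.vtx (.inl (E.up w)) :=
  E.phi_toLPA_gen _

open Classical in
theorem phi_edg (E : BipSepGraph.{u}) (x : E.Edge) :
    E.phi (E.edg x) = ∑ q with q ∈ E.newGroup x, E.next.gho q :=
  E.phi_toLPA_gen _

open Classical in
theorem phi_gho (E : BipSepGraph.{u}) (x : E.Edge) :
    E.phi (E.gho x) = ∑ q with q ∈ E.newGroup x, E.next.edg q :=
  E.phi_toLPA_gen _

/-- The connecting map `φ_n`. -/
def phiSeq (E : BipSepGraph.{u}) (n : ℕ) : LPA (E.seq n) →ₐ[ℂ] LPA (E.seq (n + 1)) :=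
  (E.seq n).phi

/-- The composition `L(E_m, C^m) → L(E_n, C^n)` of the connecting maps, for `m ≤ n`. -/
def trans (E : BipSepGraph.{u}) (m n : ℕ) (h : m ≤ n) : LPA (E.seq m) →ₐ[ℂ] LPA (E.seq n) :=
  Nat.leRecOn (C := fun n => LPA (E.seq m) →ₐ[ℂ] LPA (E.seq n)) h
    (fun {k} f => (E.phiSeq k).comp f) (AlgHom.id ℂ _)

theorem trans_self (E : BipSepGraph.{u}) (n : ℕ) : E.trans n n le_rfl = AlgHom.id ℂ _ :=
  Nat.leRecOn_self _

theorem trans_succ (E : BipSepGraph.{u}) (m n : ℕ) (h : m ≤ n) (a : LPA (E.seq m)) :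
    E.trans m (n + 1) (h.trans n.le_succ) a = E.phiSeq n (E.trans m n h a) := by
  unfold trans
  rw [Nat.leRecOn_succ h]
  rfl

instance (E : BipSepGraph.{u}) :
    DirectedSystem (fun n => LPA (E.seq n)) (fun m n h => E.trans m n h) where
  map_self n x := by
    rw [trans_self]
    rfl
  map_map k j i hij hjk x := by
    induction hjk with
    | refl => rw [trans_self]; rfl
    | step h ih => rw [trans_succ _ _ _ h, ih, ← trans_succ]

/-- The algebra `L^{ab}(E, C)`, the direct limit of the algebras `L(E_n, C^n)`. -/
abbrev Lab (E : BipSepGraph.{u}) : Type u :=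
  DirectLimit (fun n => LPA (E.seq n)) (fun m n h => E.trans m n h)

/-- The canonical map `L(E_n, C^n) → L^{ab}(E, C)`. -/
def toLab (E : BipSepGraph.{u}) (n : ℕ) : LPA (E.seq n) →ₐ[ℂ] E.Lab :=
  DirectLimit.Algebra.of (fun n => LPA (E.seq n)) (fun m n h => E.trans m n h) n

theorem toLab_phiSeq (E : BipSepGraph.{u}) (n : ℕ) (a : LPA (E.seq n)) :
    E.toLab (n + 1) (E.phiSeq n a) = E.toLab n a := by
  have h := E.trans_succ n n le_rfl a
  rw [trans_self] at h
  rw [show E.phiSeq n a = E.trans n (n + 1) n.le_succ a from h.symm]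
  exact DirectLimit.mk_apply (f := fun m n h => E.trans m n h) n (n + 1) a n.le_succ

/-- The canonical map `L(E_{n+1}, C^{n+1}) → L^{ab}(E, C)`, with its source in another form. -/
def toLabNext (E : BipSepGraph.{u}) (n : ℕ) : LPA (E.seq n).next →ₐ[ℂ] E.Lab := E.toLab (n + 1)

theorem toLab_phi (E : BipSepGraph.{u}) (n : ℕ) (a : LPA (E.seq n)) :
    E.toLab n a = E.toLabNext n ((E.seq n).phi a) := (E.toLab_phiSeq n a).symm

/-- The subalgebra of `L(E, C)` generated by the vertices. -/
def vertexSubalgebra (E : BipSepGraph.{u}) : Subalgebra ℂ (LPA E) :=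
  Algebra.adjoin ℂ (Set.range E.vtx)

/-- The algebra `B_∞`, the union in `L^{ab}(E, C)` of the images of the subalgebras `B_n` of
`L(E_n, C^n)` generated by the vertices of `E_n`. -/
def Binf (E : BipSepGraph.{u}) : Subalgebra ℂ E.Lab :=
  ⨆ n, (vertexSubalgebra (E.seq n)).map (E.toLab n)

section Binf

variable (E : BipSepGraph.{u})

/-- The image in `L^{ab}(E, C)` of a vertex of `E_n`. -/
def labV (n : ℕ) (v : (E.seq n).Vert) : E.Lab := E.toLab n ((E.seq n).vtx v)

/-- The image in `L^{ab}(E, C)` of an edge of `E_n`. -/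
def labE (n : ℕ) (x : (E.seq n).Edge) : E.Lab := E.toLab n ((E.seq n).edg x)

/-- The image in `L^{ab}(E, C)` of the adjoint of an edge of `E_n`. -/
def labG (n : ℕ) (x : (E.seq n).Edge) : E.Lab := E.toLab n ((E.seq n).gho x)

theorem Binf_eq_adjoin : E.Binf = Algebra.adjoin ℂ (⋃ n, Set.range (E.labV n)) := by
  rw [Binf, Algebra.adjoin_iUnion]
  congr 1
  funext n
  rw [vertexSubalgebra, AlgHom.map_adjoin, ← Set.range_comp]
  rfl

theorem labV_mem (n : ℕ) (v : (E.seq n).Vert) : E.labV n v ∈ E.Binf := by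
  rw [Binf_eq_adjoin]
  exact Algebra.subset_adjoin (Set.mem_iUnion.2 ⟨n, v, rfl⟩)

theorem labV_commute_self (n : ℕ) (v w : (E.seq n).Vert) :
    Commute (E.labV n v) (E.labV n w) := by
  by_cases h : v = w
  · rw [h]
  · unfold Commute SemiconjBy labV
    rw [← map_mul, ← map_mul, vtx_mul_vtx _ h, vtx_mul_vtx _ (Ne.symm h)]

open Classical in
theorem labV_inl (n : ℕ) (v : (E.seq n).V0) :
    E.labV n (.inl v) = ∑ p with (E.seq n).root p = v, E.labV (n + 1) (.inr p) := by
  rw [labV, toLab_phi, phi_vtx_inl, map_sum]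
  rfl

theorem labV_inr (n : ℕ) (v : (E.seq n).V1) :
    E.labV n (.inr v) = E.labV (n + 1) (.inl ((E.seq n).up v)) := by
  rw [labV, toLab_phi, phi_vtx_inr]
  rfl

/-- The edge of `E_n` from which an edge of `E_{n+1}` comes. -/
def baseSeq (n : ℕ) (q : (E.seq (n + 1)).Edge) : (E.seq n).Edge := (E.seq n).base q

open Classical in
theorem labE_eq (n : ℕ) (x : (E.seq n).Edge) :
    E.labE n x = ∑ q with E.baseSeq n q = x, E.labG (n + 1) q := by
  rw [labE, toLab_phi, phi_edg, map_sum]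
  rfl

open Classical in
theorem labG_eq (n : ℕ) (x : (E.seq n).Edge) :
    E.labG n x = ∑ q with E.baseSeq n q = x, E.labE (n + 1) q := by
  rw [labG, toLab_phi, phi_gho, map_sum]
  rfl

theorem labV_commute_add (n k : ℕ) (v : (E.seq n).Vert) (w : (E.seq (n + k)).Vert) :
    Commute (E.labV n v) (E.labV (n + k) w) := by
  classical
  induction k generalizing n with
  | zero => exact E.labV_commute_self n v w
  | succ k ih =>
    have key : ∀ (m : ℕ) (hm : n + 1 + k = m) (w : (E.seq m).Vert) (v : (E.seq (n + 1)).Vert),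
        Commute (E.labV (n + 1) v) (E.labV m w) := by
      rintro _ rfl w v
      exact ih (n + 1) v w
    have key' := key (n + (k + 1)) (by omega)
    rcases v with v | v
    · rw [labV_inl]
      exact Commute.sum_left _ _ _ fun p _ => key' w _
    · rw [labV_inr]
      exact key' w _

theorem labV_commute (n m : ℕ) (v : (E.seq n).Vert) (w : (E.seq m).Vert) :
    Commute (E.labV n v) (E.labV m w) := by
  rcases le_total n m with h | h
  · obtain ⟨k, rfl⟩ := Nat.exists_eq_add_of_le h
    exact E.labV_commute_add n k v w
  · obtain ⟨k, rfl⟩ := Nat.exists_eq_add_of_le h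
    exact (E.labV_commute_add m k w v).symm

theorem Binf_comm {a b : E.Lab} (ha : a ∈ E.Binf) (hb : b ∈ E.Binf) : a * b = b * a := by
  rw [Binf_eq_adjoin] at ha hb
  have := Algebra.isMulCommutative_adjoin ℂ (s := ⋃ n, Set.range (E.labV n)) (by
    simp only [Set.mem_iUnion, Set.mem_range]
    rintro _ ⟨n, v, rfl⟩ _ ⟨m, w, rfl⟩
    exact E.labV_commute n m v w)
  exact congrArg Subtype.val (mul_comm' (⟨a, ha⟩ : Algebra.adjoin ℂ (⋃ n, Set.range (E.labV n)))
    ⟨b, hb⟩)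

theorem labG_mul_labE_self (n : ℕ) (x : (E.seq n).Edge) :
    E.labG n x * E.labE n x = E.labV n (.inr ((E.seq n).s x)) := by
  rw [labG, labE, ← map_mul, gho_mul_edg_self]
  rfl

theorem labG_mul_labE (n : ℕ) {v : (E.seq n).V0} {X : Set (E.seq n).Edge} (hX : X ∈ (E.seq n).C v)
    {x y : (E.seq n).Edge} (hx : x ∈ X) (hy : y ∈ X) (h : x ≠ y) :
    E.labG n x * E.labE n y = 0 := by
  rw [labG, labE, ← map_mul, gho_mul_edg _ hX hx hy h, map_zero]

theorem labE_mul_source (n : ℕ) (x : (E.seq n).Edge) :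
    E.labE n x * E.labV n (.inr ((E.seq n).s x)) = E.labE n x := by
  rw [labV, labE, ← map_mul, edg_mul_source]

theorem source_mul_labG (n : ℕ) (x : (E.seq n).Edge) :
    E.labV n (.inr ((E.seq n).s x)) * E.labG n x = E.labG n x := by
  rw [labV, labG, ← map_mul, source_mul_gho]

theorem range_mul_labE (n : ℕ) (x : (E.seq n).Edge) :
    E.labV n (.inl ((E.seq n).r x)) * E.labE n x = E.labE n x := by
  rw [labV, labE, ← map_mul, range_mul_edg]

theorem labV_mul_labV (n : ℕ) {v w : (E.seq n).Vert} (h : v ≠ w) :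
    E.labV n v * E.labV n w = 0 := by
  rw [labV, labV, ← map_mul, vtx_mul_vtx _ h, map_zero]

theorem labE_mul_labG_mem (n : ℕ) (x : (E.seq n).Edge) : E.labE n x * E.labG n x ∈ E.Binf := by
  classical
  rw [labE, labG, ← map_mul, toLab_phi, map_mul, edg, gho, phi_toLPA_gen, phi_toLPA_gen,
    phi_edge_mul_ghost, map_sum]
  exact sum_mem fun q _ => E.labV_mem (n + 1) _

theorem labG_mul_labE_mul_labG (n : ℕ) (x : (E.seq n).Edge) :
    E.labG n x * (E.labE n x * E.labG n x) = E.labG n x := by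
  rw [← mul_assoc, labG_mul_labE_self, source_mul_labG]

theorem conj_vertex_zero (n : ℕ) (x : (E.seq n).Edge) (u : (E.seq n).Vert) :
    E.labE n x * E.labV n u * E.labG n x ∈ E.Binf ∧
      E.labG n x * E.labV n u * E.labE n x ∈ E.Binf := by
  constructor
  · by_cases h : (.inr ((E.seq n).s x)) = u
    · subst h
      rw [labE_mul_source]
      exact E.labE_mul_labG_mem n x
    · rw [← labE_mul_source, mul_assoc (E.labE n x), labV_mul_labV _ _ h, mul_zero, zero_mul]
      exact zero_mem _
  · by_cases h : u = (.inl ((E.seq n).r x))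
    · subst h
      rw [mul_assoc, range_mul_labE, labG_mul_labE_self]
      exact E.labV_mem _ _
    · rw [mul_assoc, ← range_mul_labE, ← mul_assoc (E.labV n u), labV_mul_labV _ _ h, zero_mul,
        mul_zero]
      exact zero_mem _

theorem labG_mul_labE_of_base (n : ℕ) {q q' : (E.seq (n + 1)).Edge}
    (h : E.baseSeq n q = E.baseSeq n q') (hne : q ≠ q') :
    E.labG (n + 1) q * E.labE (n + 1) q' = 0 :=
  E.labG_mul_labE (n + 1) ((E.seq n).newGroup_mem (E.baseSeq n q)) (x := q) (y := q')
    rfl h.symm hne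

theorem source_ne_of_base (n : ℕ) {q q' : (E.seq (n + 1)).Edge}
    (h : E.baseSeq n q = E.baseSeq n q') (hne : q ≠ q') :
    (E.seq (n + 1)).s q ≠ (E.seq (n + 1)).s q' := by
  obtain ⟨X, hX, hx⟩ := (E.seq n).C_cover (E.baseSeq n q)
  intro hs
  exact hne ((E.seq n).newEdge_eq hX (q := q) (q' := q') hx
    (show E.baseSeq n q' ∈ X from h ▸ hx) hs)

theorem conj_step (n : ℕ) (x : (E.seq n).Edge) {b : E.Lab} (hb : b ∈ E.Binf)
    (hk : ∀ q : (E.seq (n + 1)).Edge, E.labE (n + 1) q * b * E.labG (n + 1) q ∈ E.Binf ∧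
      E.labG (n + 1) q * b * E.labE (n + 1) q ∈ E.Binf) :
    E.labE n x * b * E.labG n x ∈ E.Binf ∧ E.labG n x * b * E.labE n x ∈ E.Binf := by
  classical
  have h1 : ∀ q q', E.baseSeq n q = E.baseSeq n q' →
      E.labG (n + 1) q * b * E.labE (n + 1) q' ∈ E.Binf := by
    intro q q' h
    by_cases hne : q = q'
    · rw [← hne]
      exact (hk q).2
    · rw [← labG_mul_labE_mul_labG, mul_assoc (E.labG (n + 1) q),
        E.Binf_comm (E.labE_mul_labG_mem (n + 1) q) hb]
      simp only [mul_assoc]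
      rw [E.labG_mul_labE_of_base n h hne]
      simp
  have h2 : ∀ q q', E.baseSeq n q = E.baseSeq n q' →
      E.labE (n + 1) q * b * E.labG (n + 1) q' ∈ E.Binf := by
    intro q q' h
    by_cases hne : q = q'
    · rw [← hne]
      exact (hk q).1
    · rw [← labE_mul_source, mul_assoc (E.labE (n + 1) q), E.Binf_comm (E.labV_mem _ _) hb,
        ← E.source_mul_labG (n + 1) q']
      have h0 := E.labV_mul_labV (n + 1) (v := .inr ((E.seq (n + 1)).s q))
        (w := .inr ((E.seq (n + 1)).s q')) (by simpa using E.source_ne_of_base n h hne)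
      have : ∀ e b v v' g : E.Lab, v * v' = 0 → e * (b * v) * (v' * g) = 0 := by
        intro e b v v' g hv
        rw [mul_assoc, mul_assoc b, ← mul_assoc v, hv, zero_mul, mul_zero, mul_zero]
      rw [this _ _ _ _ _ h0]
      exact zero_mem _
  rw [labE_eq, labG_eq]
  simp only [Finset.sum_mul, Finset.mul_sum]
  constructor
  · refine sum_mem fun q hq => sum_mem fun q' hq' => ?_
    simp only [Finset.mem_filter, Finset.mem_univ, true_and] at hq hq'
    first | exact h1 q q' (hq.trans hq'.symm) | exact h1 q' q (hq'.trans hq.symm)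
  · refine sum_mem fun q hq => sum_mem fun q' hq' => ?_
    simp only [Finset.mem_filter, Finset.mem_univ, true_and] at hq hq'
    first | exact h2 q q' (hq.trans hq'.symm) | exact h2 q' q (hq'.trans hq.symm)

theorem conj_vertex (n : ℕ) (k : ℕ) (x : (E.seq n).Edge) (u : (E.seq (n + k)).Vert) :
    E.labE n x * E.labV (n + k) u * E.labG n x ∈ E.Binf ∧
      E.labG n x * E.labV (n + k) u * E.labE n x ∈ E.Binf := by
  induction k generalizing n with
  | zero => exact E.conj_vertex_zero n x u
  | succ k ih =>
    have key : ∀ (m : ℕ) (hm : n + 1 + k = m) (u : (E.seq m).Vert) (q : (E.seq (n + 1)).Edge),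
        E.labE (n + 1) q * E.labV m u * E.labG (n + 1) q ∈ E.Binf ∧
          E.labG (n + 1) q * E.labV m u * E.labE (n + 1) q ∈ E.Binf := by
      rintro _ rfl u q
      exact ih (n + 1) q u
    exact E.conj_step n x (E.labV_mem _ u) (key (n + (k + 1)) (by omega) u)

theorem labV_mem_vertexSpan (n k : ℕ) (v : (E.seq n).Vert) :
    E.labV n v ∈ Submodule.span ℂ (Set.range (E.labV (n + k))) := by
  classical
  induction k with
  | zero => exact Submodule.subset_span ⟨v, rfl⟩
  | succ k ih =>
    refine Submodule.span_le.2 ?_ ih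
    rintro _ ⟨w, rfl⟩
    rcases w with w | w
    · rw [labV_inl]
      exact sum_mem fun p _ => Submodule.subset_span ⟨_, rfl⟩
    · rw [labV_inr]
      exact Submodule.subset_span ⟨_, rfl⟩

theorem conj_labV (n m : ℕ) (x : (E.seq n).Edge) (v : (E.seq m).Vert) :
    E.labE n x * E.labV m v * E.labG n x ∈ E.Binf ∧
      E.labG n x * E.labV m v * E.labE n x ∈ E.Binf := by
  have h := E.labV_mem_vertexSpan m n v
  rw [Nat.add_comm m n] at h
  generalize E.labV m v = b at h
  induction h using Submodule.span_induction with
  | mem b hb =>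
    obtain ⟨u, rfl⟩ := hb
    exact E.conj_vertex n m x u
  | zero => simp
  | add a b _ _ ha hb =>
    simp only [mul_add, add_mul]
    exact ⟨add_mem ha.1 hb.1, add_mem ha.2 hb.2⟩
  | smul c b _ hb =>
    simp only [mul_smul_comm, smul_mul_assoc]
    exact ⟨Subalgebra.smul_mem _ hb.1 c, Subalgebra.smul_mem _ hb.2 c⟩

theorem labG_conj_mul (n : ℕ) (x : (E.seq n).Edge) {a b : E.Lab} (ha : a ∈ E.Binf) :
    E.labG n x * (a * b) * E.labE n x =
      (E.labG n x * a * E.labE n x) * (E.labG n x * b * E.labE n x) := by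
  have hc := E.Binf_comm ha (E.labE_mul_labG_mem n x)
  calc E.labG n x * (a * b) * E.labE n x
      = E.labG n x * (E.labE n x * E.labG n x) * a * b * E.labE n x := by
        rw [labG_mul_labE_mul_labG]; simp only [mul_assoc]
    _ = E.labG n x * ((E.labE n x * E.labG n x) * a) * b * E.labE n x := by
        simp only [mul_assoc]
    _ = E.labG n x * (a * (E.labE n x * E.labG n x)) * b * E.labE n x := by rw [hc]
    _ = _ := by simp only [mul_assoc]

/-- The algebra `B_∞` is invariant under `b ↦ x^* b x`. -/
theorem labG_conj_mem (n : ℕ) (x : (E.seq n).Edge) {b : E.Lab} (hb : b ∈ E.Binf) :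
    E.labG n x * b * E.labE n x ∈ E.Binf := by
  rw [Binf_eq_adjoin] at hb
  induction hb using Algebra.adjoin_induction with
  | mem b hb =>
    obtain ⟨m, v, rfl⟩ := Set.mem_iUnion.1 hb
    exact (E.conj_labV n m x v).2
  | algebraMap c =>
    rw [Algebra.algebraMap_eq_smul_one, mul_smul_comm, mul_one, smul_mul_assoc,
      labG_mul_labE_self]
    exact Subalgebra.smul_mem _ (E.labV_mem _ _) c
  | add a b ha hb iha ihb =>
    rw [mul_add, add_mul]
    exact add_mem iha ihb
  | mul a b ha hb iha ihb =>
    rw [← Binf_eq_adjoin] at ha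
    rw [E.labG_conj_mul n x ha]
    exact mul_mem iha ihb

end Binf

/-! ### Dynamical systems -/

/-- The data of an `(E, C)`-dynamical system on a space `Ω`: subsets `Ω_v` for the vertices `v`,
subsets `H_x` for the edges `x`, and maps `θ_x : Ω_{s(x)} → H_x`. -/
structure DynData (E : BipSepGraph.{u}) (Ω : Type w) where
  dom : E.Vert → Set Ω
  H : E.Edge → Set Ω
  θ : ∀ x : E.Edge, dom (.inr (E.s x)) → H x

/-- The data `S` form an `(E, C)`-dynamical system: `Ω` is a compact Hausdorff space, the disjoint
union of its clopen subsets `Ω_v`, the `H_x` with `r(x) = v` are clopen subsets of `Ω_v`,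
`Ω_v` is the disjoint union of the `H_x`, `x ∈ X`, for each `X ∈ C_v`, and the maps
`θ_x : Ω_{s(x)} → H_x` are homeomorphisms. -/
structure IsDynSystem {E : BipSepGraph.{u}} {Ω : Type w} [TopologicalSpace Ω]
    (S : DynData E Ω) : Prop where
  compactSpace : CompactSpace Ω
  t2Space : T2Space Ω
  isClopen_dom : ∀ v, IsClopen (S.dom v)
  iUnion_dom : ⋃ v, S.dom v = Set.univ
  disjoint_dom : ∀ v w, v ≠ w → Disjoint (S.dom v) (S.dom w)
  isClopen_H : ∀ x, IsClopen (S.H x)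
  H_subset : ∀ x, S.H x ⊆ S.dom (.inl (E.r x))
  iUnion_H : ∀ v, ∀ X ∈ E.C v, ⋃ x ∈ X, S.H x = S.dom (.inl v)
  disjoint_H : ∀ v, ∀ X ∈ E.C v, ∀ x ∈ X, ∀ y ∈ X, x ≠ y → Disjoint (S.H x) (S.H y)
  isHomeomorph_θ : ∀ x, IsHomeomorph (S.θ x)

/-- Equivariant maps: `f(Ω_v) ⊆ Ω'_v`, `f(H_x) ⊆ H'_x` and `f(θ_x(y)) = θ'_x(f(y))` for all `y`
in `Ω_{s(x)}`. -/
structure IsEquivariant {E : BipSepGraph.{u}} {Ω : Type w} {Ω' : Type*} (S : DynData E Ω)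
    (S' : DynData E Ω') (f : Ω → Ω') : Prop where
  map_dom : ∀ v, Set.MapsTo f (S.dom v) (S'.dom v)
  map_H : ∀ x, Set.MapsTo f (S.H x) (S'.H x)
  map_θ : ∀ (x : E.Edge) (y : S.dom (.inr (E.s x))),
    f (S.θ x y) = S'.θ x ⟨f y, map_dom _ y.2⟩

/-! ### The dynamical system `Ω(E, C)` -/

/-- The space `Ω(E, C)`: the spectrum of the commutative algebra `B_∞`, that is, the set of its
characters, with the topology of pointwise convergence. (`B_∞` is spanned by commuting projections,
so its characters preserve the involution and are the restrictions of the characters of its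
C*-completion.) -/
def Omega (E : BipSepGraph.{u}) : Type u := E.Binf →ₐ[ℂ] ℂ

/-- The value `χ(b)` of a character at an element of `B_∞`. -/
def Omega.eval {E : BipSepGraph.{u}} (χ : E.Omega) (b : E.Binf) : ℂ := AlgHom.toRingHom χ b

instance (E : BipSepGraph.{u}) : TopologicalSpace E.Omega :=
  TopologicalSpace.induced (fun χ b => χ.eval b) inferInstance

/-- The image `x̲` of an edge `x` of `E` in `L^{ab}(E, C)`. -/
def edgeLab (E : BipSepGraph.{u}) (x : E.Edge) : E.Lab := E.labE 0 x

/-- The adjoint of the image of an edge `x` of `E` in `L^{ab}(E, C)`. -/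
def ghostLab (E : BipSepGraph.{u}) (x : E.Edge) : E.Lab := E.labG 0 x

/-- The vertex `v` of `E` as a projection in `B_∞`. -/
def vertProj (E : BipSepGraph.{u}) (v : E.Vert) : E.Binf := ⟨E.labV 0 v, E.labV_mem 0 v⟩

/-- The projection `x x^*` in `B_∞`, for an edge `x` of `E`. -/
def edgeProj (E : BipSepGraph.{u}) (x : E.Edge) : E.Binf :=
  ⟨E.edgeLab x * E.ghostLab x, E.labE_mul_labG_mem 0 x⟩

theorem ghostLab_mul_edgeLab (E : BipSepGraph.{u}) (x : E.Edge) :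
    E.ghostLab x * E.edgeLab x = (E.vertProj (.inr (E.s x))).1 := E.labG_mul_labE_self 0 x

theorem ghostLab_mul_edgeProj (E : BipSepGraph.{u}) (x : E.Edge) :
    E.ghostLab x * (E.edgeProj x).1 = E.ghostLab x := E.labG_mul_labE_mul_labG 0 x

/-- The map `b ↦ x^* b x` on `B_∞`, for an edge `x` of `E`. On `x x^* B_∞` it is the inverse of
the isomorphism `α_x : x^* x B_∞ → x x^* B_∞`, `b ↦ x b x^*`. -/
def conj (E : BipSepGraph.{u}) (x : E.Edge) : E.Binf →ₗ[ℂ] E.Binf where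
  toFun b := ⟨E.ghostLab x * b.1 * E.edgeLab x, E.labG_conj_mem 0 x b.2⟩
  map_add' a b := Subtype.ext (by simp [mul_add, add_mul])
  map_smul' c b := Subtype.ext (by simp)

theorem conj_val (E : BipSepGraph.{u}) (x : E.Edge) (b : E.Binf) :
    (E.conj x b).1 = E.ghostLab x * b.1 * E.edgeLab x := rfl

theorem conj_one (E : BipSepGraph.{u}) (x : E.Edge) :
    E.conj x 1 = E.vertProj (.inr (E.s x)) :=
  Subtype.ext (by
    rw [conj_val, ← ghostLab_mul_edgeLab]
    simp)

theorem conj_mul (E : BipSepGraph.{u}) (x : E.Edge) (a b : E.Binf) :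
    E.conj x (a * b) = E.conj x a * E.conj x b :=
  Subtype.ext (E.labG_conj_mul 0 x a.2)

theorem conj_edgeProj (E : BipSepGraph.{u}) (x : E.Edge) :
    E.conj x (E.edgeProj x) = E.vertProj (.inr (E.s x)) :=
  Subtype.ext (by rw [conj_val, ghostLab_mul_edgeProj, ghostLab_mul_edgeLab])

/-- The dual of `α_x`: a character `χ` with `χ(x^* x) = 1` goes to the character
`b ↦ χ(α_x⁻¹(x x^* b)) = χ(x^* b x)`. -/
def omegaMap (E : BipSepGraph.{u}) (x : E.Edge) (χ : E.Omega)
    (h : χ.eval (E.vertProj (.inr (E.s x))) = 1) : E.Omega :=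
  AlgHom.ofLinearMap ((AlgHom.toLinearMap χ).comp (E.conj x))
    (by
      change χ.eval (E.conj x 1) = 1
      rw [conj_one, h])
    (fun a b => by
      change χ.eval (E.conj x (a * b)) = χ.eval (E.conj x a) * χ.eval (E.conj x b)
      rw [conj_mul]
      exact map_mul (AlgHom.toRingHom χ) _ _)

theorem omegaMap_eval (E : BipSepGraph.{u}) (x : E.Edge) (χ : E.Omega)
    (h : χ.eval (E.vertProj (.inr (E.s x))) = 1) (b : E.Binf) :
    (E.omegaMap x χ h).eval b = χ.eval (E.conj x b) := rfl

/-- The pair `(Ω(E, C), α^*)`: `Ω_v` is the set of characters with `χ(v) = 1`, `H_x` is the set of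
characters with `χ(x x^*) = 1`, and `θ_x : Ω_{s(x)} → H_x` is the dual of the isomorphism
`α_x : x^* x B_∞ → x x^* B_∞` given by conjugation with `x`. -/
def omegaSystem (E : BipSepGraph.{u}) : DynData E E.Omega where
  dom v := {χ | χ.eval (E.vertProj v) = 1}
  H x := {χ | χ.eval (E.edgeProj x) = 1}
  θ x χ := ⟨E.omegaMap x χ.1 χ.2, by
    change (E.omegaMap x χ.1 χ.2).eval _ = 1
    rw [omegaMap_eval, conj_edgeProj]
    exact χ.2⟩

end BipSepGraph

end

/-! That characters of `B_∞` form a dynamical system is spectral bookkeeping. Vertices and the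
elements `x x^*` are idempotents, so a character takes only the values 0 and 1 on them, and the
Leavitt relations become partitions into clopen sets. The space is compact because it is a closed
subset of a product of discs (`Omega.exists_bound`, `Omega.isClosed_range_eval`). The dual maps are
bijective because `b ↦ x^* b x` and `b ↦ x b x^*` are mutually inverse between the corners cut out
by `x x^*` and `s(x)`.

Existence comes from a representation. A system `(Ω, θ)` lets `L(E, C)` act on all functions `Ω →
ℂ`: a vertex multiplies by the indicator of `Ω_v`, `x^*` sends `g` to `g ∘ θ_x` extended by zero,
and `x` does the same with `θ_x⁻¹`. The same space carries a system of every `(E_n, C^n)`: the set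
of `v(x_1, …, x_k)` is the intersection of the `H_{x_i}`, and `α^x(…)` acts by a restriction of
`θ_x⁻¹`. These representations respect the connecting maps (`HomeoSystem.rep_next_comp_phi`), hence
pass to `L^{ab}(E, C)`. There `B_∞` acts by multiplication by continuous functions, so `b ↦ (b ·
1)(y)` is a character depending continuously on `y`; this is the required map.

For uniqueness, an equivariant map is automatically equivariant at every level `n`
(`HomeoSystem.Intertwines.next`). Hence `f y` is 1 on the one vertex of `E_n` whose set contains `y`
and 0 on the others, and these projections generate `B_∞`. -/

noncomputable section

namespace BipSepGraph

/-! ### Systems of partial homeomorphisms and their refinement to the next graph -/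

/-- A dynamical system of a separated graph whose maps are recorded as partial homeomorphisms of
the whole space, with `(θ x).target` playing the role of `H_x`. -/
structure HomeoSystem (E : BipSepGraph.{u}) (Ω : Type w) [TopologicalSpace Ω] where
  dom : E.Vert → Set Ω
  θ : E.Edge → OpenPartialHomeomorph Ω Ω
  isClopen_dom : ∀ v, IsClopen (dom v)
  exists_mem_dom : ∀ y, ∃ v, y ∈ dom v
  dom_unique : ∀ {v v' y}, y ∈ dom v → y ∈ dom v' → v = v'
  source_eq : ∀ x, (θ x).source = dom (.inr (E.s x))
  isClopen_target : ∀ x, IsClopen (θ x).target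
  target_subset : ∀ x, (θ x).target ⊆ dom (.inl (E.r x))
  exists_mem_target : ∀ {v X y}, X ∈ E.C v → y ∈ dom (.inl v) → ∃ x ∈ X, y ∈ (θ x).target
  target_unique : ∀ {v X x x' y}, X ∈ E.C v → x ∈ X → x' ∈ X → y ∈ (θ x).target →
    y ∈ (θ x').target → x = x'

namespace HomeoSystem

section Indicator

variable {Ω : Type w}

/-- Multiplication by the indicator function of a set. -/
def indOp (A : Set Ω) : Module.End ℂ (Ω → ℂ) where
  toFun f := A.indicator f
  map_add' f g := by ext y; by_cases h : y ∈ A <;> simp [h]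
  map_smul' c f := by ext y; by_cases h : y ∈ A <;> simp [h]

open Classical in
theorem indOp_apply (A : Set Ω) (f : Ω → ℂ) (y : Ω) :
    indOp A f y = if y ∈ A then f y else 0 := rfl

/-- Exactly one summand survives at a point of a disjoint union. Every relation expressing a vertex
or the unit as a sum of projections reduces to this. -/
theorem sum_indOp {ι : Type*} (I : Finset ι) (A : ι → Set Ω) (B : Set Ω)
    (hsub : ∀ i ∈ I, A i ⊆ B) (hcov : ∀ y ∈ B, ∃ i ∈ I, y ∈ A i)
    (hu : ∀ i ∈ I, ∀ j ∈ I, ∀ y, y ∈ A i → y ∈ A j → i = j) :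
    ∑ i ∈ I, indOp (A i) = indOp B := by
  classical
  ext f y
  rw [LinearMap.sum_apply, Finset.sum_apply]
  simp only [indOp_apply]
  by_cases hy : y ∈ B
  · obtain ⟨i, hi, hyi⟩ := hcov y hy
    rw [Finset.sum_eq_single_of_mem i hi, if_pos hyi, if_pos hy]
    exact fun j hj hne => if_neg fun h => hne (hu j hj i hi y h hyi)
  · rw [if_neg hy]
    exact Finset.sum_eq_zero fun i hi => if_neg fun h => hy (hsub i hi h)

theorem indOp_mul (A B : Set Ω) : indOp A * indOp B = indOp (A ∩ B) := by
  classical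
  ext f y
  simp only [Module.End.mul_apply, indOp_apply, Set.mem_inter_iff]
  split_ifs <;> tauto

theorem indOp_univ : indOp (Set.univ : Set Ω) = 1 := by
  ext f y
  simp [indOp]

theorem indOp_empty : indOp (∅ : Set Ω) = 0 := by
  ext f y
  simp [indOp]

end Indicator

variable {E : BipSepGraph.{u}} {Ω : Type w} [TopologicalSpace Ω] (S : HomeoSystem E Ω)

/-- The sets attached to the vertices of `(E_1, C^1)`. -/
def nextDom : E.next.Vert → Set Ω
  | .inl w => S.dom (.inr w)
  | .inr p => ⋂ X : E.C (Sigma.fst p), (S.θ ((Sigma.snd p).1 X)).target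

theorem isClopen_nextDom (v : E.next.Vert) : IsClopen (S.nextDom v) := by
  rcases v with w | p
  · exact S.isClopen_dom _
  · exact isClopen_iInter_of_finite fun X => S.isClopen_target _

/-- Surjectivity of `r` makes `C_u` nonempty, so the defining intersection is not an empty one, and
any one of its factors `H_x` already lies in `Ω_u`. -/
theorem nextDom_inr_subset (p : E.next.V1) : S.nextDom (.inr p) ⊆ S.dom (.inl (E.root p)) := by
  intro y hy
  obtain ⟨x, hx⟩ := E.r_surj (Sigma.fst p)
  obtain ⟨X, hX, -⟩ := E.C_cover x
  rw [hx] at hX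
  have h := S.target_subset _ (Set.mem_iInter.1 hy ⟨X, hX⟩)
  rwa [E.C_subset _ _ hX _ ((Sigma.snd p).2 ⟨X, hX⟩)] at h

/-- For each `X` in `C_v` the point lies in some `H_x` with `x ∈ X`; these choices are the data of a
new vertex. -/
theorem exists_mem_nextDom_inr {v : E.V0} {y : Ω} (hy : y ∈ S.dom (.inl v)) :
    ∃ p, E.root p = v ∧ y ∈ S.nextDom (.inr p) := by
  choose c hc hy using fun X : E.C v => S.exists_mem_target X.2 hy
  exact ⟨⟨v, c, hc⟩, rfl, Set.mem_iInter.2 hy⟩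

theorem nextDom_inr_unique {p p' : E.next.V1} {y : Ω} (h : y ∈ S.nextDom (.inr p))
    (h' : y ∈ S.nextDom (.inr p')) : p = p' := by
  have hr := Sum.inl_injective
    (S.dom_unique (S.nextDom_inr_subset p h) (S.nextDom_inr_subset p' h'))
  obtain ⟨u, c, hc⟩ := p
  obtain ⟨u', c', hc'⟩ := p'
  obtain rfl : u = u' := hr
  have : c = c' := funext fun X =>
    S.target_unique X.2 (hc X) (hc' X) (Set.mem_iInter.1 h X) (Set.mem_iInter.1 h' X)
  subst this
  rfl

/-- Since the base edge of `q` is one of the `x_i`, its `H` is among the intersected sets;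
restricting the inverse map to the new vertex set therefore loses no point of that set. -/
theorem nextDom_subset_target (q : E.next.Edge) :
    S.nextDom (.inr (E.next.s q)) ⊆ (S.θ (E.base q)).target :=
  Set.iInter_subset (fun X : E.C (Sigma.fst (E.next.s q)) =>
    (S.θ ((Sigma.snd (E.next.s q)).1 X)).target) (Sigma.snd q)

/-- The partial homeomorphisms attached to the edges of `(E_1, C^1)`. -/
def nextθ (q : E.next.Edge) : OpenPartialHomeomorph Ω Ω :=
  -- The inverse appears because the source of `α^x(…)` lies over `r(x)` and its range is `s(x)`;
  -- accordingly the connecting map sends `x` to a sum of adjoints.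
  (S.θ (E.base q)).symm.restrOpen (S.nextDom (.inr (E.next.s q))) (S.isClopen_nextDom _).isOpen

theorem nextθ_source (q : E.next.Edge) : (S.nextθ q).source = S.nextDom (.inr (E.next.s q)) :=
  Set.inter_eq_right.2 (S.nextDom_subset_target q)

theorem mem_nextθ_target {q : E.next.Edge} {y : Ω} : y ∈ (S.nextθ q).target ↔
    y ∈ S.dom (.inr (E.s (E.base q))) ∧
      S.θ (E.base q) y ∈ S.nextDom (.inr (E.next.s q)) := by
  rw [← source_eq]
  rfl

/-- The image `θ_x y` lies in the set of some new vertex. As it also lies in `H_x`, the edge chosen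
there in the group of `x` must be `x` itself. -/
theorem exists_mem_nextθ_target {x : E.Edge} {y : Ω} (hy : y ∈ S.dom (.inr (E.s x))) :
    ∃ q, E.base q = x ∧ y ∈ (S.nextθ q).target := by
  have hx : S.θ x y ∈ (S.θ x).target := (S.θ x).map_source (by rwa [source_eq])
  obtain ⟨p, hp, hyp⟩ := S.exists_mem_nextDom_inr (S.target_subset x hx)
  obtain ⟨X, hX, hxX⟩ := E.C_cover x
  obtain ⟨q, rfl, hqX⟩ := E.exists_newEdge hX p hp
  have : E.base q = x :=
    S.target_unique hX hqX hxX (S.nextDom_subset_target q hyp) hx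
  subst this
  exact ⟨q, rfl, S.mem_nextθ_target.2 ⟨hy, hyp⟩⟩

/-- The dynamical system of `(E_1, C^1)` on the same space. -/
def next : HomeoSystem E.next Ω where
  dom := S.nextDom
  θ := S.nextθ
  isClopen_dom := S.isClopen_nextDom
  exists_mem_dom y := by
    obtain ⟨v | w, h⟩ := S.exists_mem_dom y
    · obtain ⟨p, -, hp⟩ := S.exists_mem_nextDom_inr h
      exact ⟨_, hp⟩
    · exact ⟨.inl (E.up w), h⟩
  dom_unique {v v' y} h h' := by
    rcases v with w | p <;> rcases v' with w' | p'
    · exact congrArg Sum.inl (Sum.inr_injective (S.dom_unique h h'))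
    · cases S.dom_unique h (S.nextDom_inr_subset p' h')
    · cases S.dom_unique (S.nextDom_inr_subset p h) h'
    · rw [S.nextDom_inr_unique h h']
  source_eq := S.nextθ_source
  isClopen_target q := by
    refine ⟨?_, (S.nextθ q).open_target⟩
    rw [← isOpen_compl_iff]
    -- A preimage under a partial homeomorphism is controlled only inside its source, so the
    -- complement is split into the points outside the clopen source and those inside it that miss
    -- the vertex set.
    have : (S.nextθ q).targetᶜ = (S.dom (.inr (E.s (E.base q))))ᶜ ∪
        ((S.θ (E.base q)).source ∩
          S.θ (E.base q) ⁻¹' (S.nextDom (.inr (E.next.s q)))ᶜ) := by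
      ext y
      rw [Set.mem_compl_iff, mem_nextθ_target, source_eq]
      simp only [Set.mem_union, Set.mem_compl_iff, Set.mem_inter_iff, Set.mem_preimage]
      tauto
    rw [this]
    exact (S.isClopen_dom _).compl.isOpen.union
      ((S.θ _).isOpen_inter_preimage (S.isClopen_nextDom _).compl.isOpen)
  target_subset q y hy := (S.mem_nextθ_target.1 hy).1
  exists_mem_target := by
    rintro _ _ y ⟨x, rfl, rfl⟩ hy
    exact S.exists_mem_nextθ_target hy
  target_unique := by
    rintro _ _ q q' y ⟨x, rfl, rfl⟩ rfl hq' h h'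
    obtain ⟨X, hX, hxX⟩ := E.C_cover (E.base q)
    have hb : E.base q' = E.base q := hq'
    refine E.newEdge_eq hX hxX (hb ▸ hxX) ?_
    have h2 := (S.mem_nextθ_target.1 h').2
    rw [hb] at h2
    exact S.nextDom_inr_unique (S.mem_nextθ_target.1 h).2 h2

/-- The dynamical system of `(E_n, C^n)` on the same space. -/
def seq : ∀ n, HomeoSystem (E.seq n) Ω
  | 0 => S
  | n + 1 => (seq n).next

/-! ### Representation of the Leavitt algebras on functions -/

/-- The weighted composition operator of a partial homeomorphism. -/
def compOp (e : OpenPartialHomeomorph Ω Ω) : Module.End ℂ (Ω → ℂ) where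
  toFun f := e.source.indicator (f ∘ e)
  map_add' f g := by ext y; by_cases h : y ∈ e.source <;> simp [h]
  map_smul' c f := by ext y; by_cases h : y ∈ e.source <;> simp [h]

open Classical in
theorem compOp_apply (e : OpenPartialHomeomorph Ω Ω) (f : Ω → ℂ) (y : Ω) :
    compOp e f y = if y ∈ e.source then f (e y) else 0 := rfl

/-- The operators on functions attached to the generators of the Leavitt path algebra. -/
def genOp : Gen E → Module.End ℂ (Ω → ℂ)
  | .vert v => indOp (S.dom v)
  -- Composition is contravariant: to carry functions on `Ω_{s(x)}` to functions on `H_x` one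
  -- composes with the inverse of `θ_x`.
  | .edge x => compOp (S.θ x).symm
  | .ghost x => compOp (S.θ x)

/-- Cutting a partial homeomorphism into restrictions with disjoint sources decomposes its operator.
This is the form taken by `φ(x) = ∑ z^*`. -/
theorem sum_compOp {ι : Type*} (I : Finset ι) (e : ι → OpenPartialHomeomorph Ω Ω)
    (e₀ : OpenPartialHomeomorph Ω Ω)
    (hsub : ∀ i ∈ I, ∀ y ∈ (e i).source, y ∈ e₀.source ∧ e i y = e₀ y)
    (hcov : ∀ y ∈ e₀.source, ∃ i ∈ I, y ∈ (e i).source)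
    (hu : ∀ i ∈ I, ∀ j ∈ I, ∀ y, y ∈ (e i).source → y ∈ (e j).source → i = j) :
    ∑ i ∈ I, compOp (e i) = compOp e₀ := by
  classical
  ext f y
  rw [LinearMap.sum_apply, Finset.sum_apply]
  simp only [compOp_apply]
  by_cases hy : y ∈ e₀.source
  · obtain ⟨i, hi, hyi⟩ := hcov y hy
    rw [Finset.sum_eq_single_of_mem i hi, if_pos hyi, if_pos hy, (hsub i hi y hyi).2]
    exact fun j hj hne => if_neg fun h => hne (hu j hj i hi y h hyi)
  · rw [if_neg hy]
    exact Finset.sum_eq_zero fun i hi => if_neg fun h => hy (hsub i hi y h).1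

theorem compOp_symm_mul (e : OpenPartialHomeomorph Ω Ω) :
    compOp e.symm * compOp e = indOp e.target := by
  classical
  ext f y
  simp only [Module.End.mul_apply, indOp_apply, compOp_apply,
    OpenPartialHomeomorph.symm_source]
  by_cases hy : y ∈ e.target
  · simp [hy]
  · simp [hy]

theorem compOp_mul_symm (e : OpenPartialHomeomorph Ω Ω) :
    compOp e * compOp e.symm = indOp e.source := by
  simpa using compOp_symm_mul e.symm

theorem indOp_mul_compOp {A : Set Ω} {e : OpenPartialHomeomorph Ω Ω} (h : e.source ⊆ A) :
    indOp A * compOp e = compOp e := by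
  classical
  ext f y
  simp only [Module.End.mul_apply, indOp_apply, compOp_apply]
  by_cases hy : y ∈ e.source
  · simp [hy, h hy]
  · simp [hy]

theorem compOp_mul_indOp {A : Set Ω} {e : OpenPartialHomeomorph Ω Ω} (h : e.target ⊆ A) :
    compOp e * indOp A = compOp e := by
  classical
  ext f y
  simp only [Module.End.mul_apply, indOp_apply, compOp_apply]
  by_cases hy : y ∈ e.source
  · simp [hy, h (e.map_source hy)]
  · simp [hy]

theorem compOp_mul_symm_of_disjoint {e e' : OpenPartialHomeomorph Ω Ω}
    (h : ∀ y, y ∈ e.target → y ∉ e'.target) : compOp e * compOp e'.symm = 0 := by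
  classical
  ext f y
  simp only [Module.End.mul_apply, compOp_apply]
  by_cases hy : y ∈ e.source
  · simp [hy, h _ (e.map_source hy)]
  · simp [hy]

/-- Each relation translates into a fact about sets: `x^* x` and `x x^*` become the indicators of
the source and target of `θ_x`, orthogonality is disjointness, and the sum relations are coverings.
-/
theorem genOp_respects ⦃a b : FreeAlgebra ℂ (Gen E)⦄ (h : LeavittRel E a b) :
    FreeAlgebra.lift ℂ S.genOp a = FreeAlgebra.lift ℂ S.genOp b := by
  classical
  induction h with
  | vert_mul_self v =>
    simp only [gen, map_mul, FreeAlgebra.lift_ι_apply, genOp, indOp_mul, Set.inter_self]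
  | vert_mul_vert v w hne =>
    simp only [gen, map_mul, FreeAlgebra.lift_ι_apply, genOp, indOp_mul, map_zero]
    rw [← indOp_empty]
    congr 1
    exact Set.eq_empty_of_forall_notMem fun y hy => hne (S.dom_unique hy.1 hy.2)
  | sum_vert =>
    simp only [gen, map_sum, FreeAlgebra.lift_ι_apply, genOp, map_one]
    rw [← indOp_univ]
    refine sum_indOp _ _ _ (fun _ _ => Set.subset_univ _) (fun y _ => ?_)
      fun i _ j _ y => S.dom_unique
    simpa using S.exists_mem_dom y
  | range_mul_edge x =>
    simp only [gen, map_mul, FreeAlgebra.lift_ι_apply, genOp]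
    exact indOp_mul_compOp (S.target_subset x)
  | edge_mul_source x =>
    simp only [gen, map_mul, FreeAlgebra.lift_ι_apply, genOp]
    exact compOp_mul_indOp (S.source_eq x).subset
  | ghost_mul_range x =>
    simp only [gen, map_mul, FreeAlgebra.lift_ι_apply, genOp]
    exact compOp_mul_indOp (S.target_subset x)
  | source_mul_ghost x =>
    simp only [gen, map_mul, FreeAlgebra.lift_ι_apply, genOp]
    exact indOp_mul_compOp (S.source_eq x).subset
  | ghost_mul_edge_self x =>
    simp only [gen, map_mul, FreeAlgebra.lift_ι_apply, genOp, compOp_mul_symm, source_eq]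
  | ghost_mul_edge v X hX x y hx hy hne =>
    simp only [gen, map_mul, FreeAlgebra.lift_ι_apply, genOp, map_zero]
    exact compOp_mul_symm_of_disjoint fun z h h' => hne (S.target_unique hX hx hy h h')
  | sum_edge_mul_ghost v X hX =>
    simp only [gen, map_mul, map_sum, FreeAlgebra.lift_ι_apply, genOp, compOp_symm_mul]
    refine sum_indOp _ _ _ (fun x hx => ?_) (fun y hy => ?_) fun x hx x' hx' y => ?_
    · have h := S.target_subset x
      rwa [E.C_subset v X hX x (by simpa using hx)] at h
    · simpa using S.exists_mem_target hX hy
    · exact S.target_unique hX (by simpa using hx) (by simpa using hx')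

/-- The representation of the Leavitt path algebra on the functions on the space. -/
def rep : LPA E →ₐ[ℂ] Module.End ℂ (Ω → ℂ) :=
  RingQuot.liftAlgHom ℂ ⟨FreeAlgebra.lift ℂ S.genOp, S.genOp_respects⟩

theorem rep_toLPA_gen (g : Gen E) : S.rep (E.toLPA (E.gen g)) = S.genOp g := by
  refine (RingQuot.liftAlgHom_mkAlgHom_apply ℂ (FreeAlgebra.lift ℂ S.genOp) S.genOp_respects
    (E.gen g)).trans (FreeAlgebra.lift_ι_apply _ _)

theorem rep_vtx (v : E.Vert) : S.rep (E.vtx v) = indOp (S.dom v) := S.rep_toLPA_gen _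

theorem rep_edg (x : E.Edge) : S.rep (E.edg x) = compOp (S.θ x).symm := S.rep_toLPA_gen _

theorem rep_gho (x : E.Edge) : S.rep (E.gho x) = compOp (S.θ x) := S.rep_toLPA_gen _

/-- The set of `u` is the disjoint union of its new vertex sets, and `θ_x` and its inverse are
disjoint unions of the maps of the edges over `x`, or of their inverses. Hence refining the system
does not change the operators. -/
theorem rep_next_phiGen (g : Gen E) : S.next.rep (E.phiGen g) = S.genOp g := by
  classical
  rcases g with (v | w) | x | x
  · simp only [phiGen, map_sum, rep_vtx, genOp]
    refine sum_indOp _ _ _ (fun p hp => ?_) (fun y hy => ?_) fun p _ p' _ y =>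
      S.nextDom_inr_unique
    · have h := S.nextDom_inr_subset p
      rwa [show E.root p = v by simpa using hp] at h
    · obtain ⟨p, hp, hyp⟩ := S.exists_mem_nextDom_inr hy
      exact ⟨p, by simpa using hp, hyp⟩
  · exact S.next.rep_vtx _
  · simp only [phiGen, map_sum, rep_gho, genOp]
    refine sum_compOp _ _ _ (fun q hq y hy => ?_) (fun y hy => ?_) fun q hq q' hq' y hy hy' => ?_
    · obtain rfl : E.base q = x := by simpa [mem_newGroup] using hq
      rw [source_eq] at hy
      exact ⟨S.nextDom_subset_target q hy, rfl⟩
    · have hy' : y ∈ (S.θ x).target := hy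
      -- The covering is known on `Ω_{s(x)}`, so `y` is pulled back there and the resulting
      -- membership is pushed forward again.
      obtain ⟨q, hq, hyq⟩ := S.exists_mem_nextθ_target (x := x) (y := (S.θ x).symm y)
        (by rw [← source_eq]; exact (S.θ x).map_target hy')
      refine ⟨q, by simpa [mem_newGroup] using hq, ?_⟩
      rw [source_eq]
      have := (S.mem_nextθ_target.1 hyq).2
      rwa [hq, (S.θ x).right_inv hy'] at this
    · obtain ⟨X, hX, hxX⟩ := E.C_cover x
      simp only [Finset.mem_filter, Finset.mem_univ, true_and, mem_newGroup] at hq hq'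
      rw [source_eq] at hy hy'
      exact E.newEdge_eq hX (hq ▸ hxX) (hq' ▸ hxX) (S.nextDom_inr_unique hy hy')
  · simp only [phiGen, map_sum, rep_edg, genOp]
    refine sum_compOp _ _ _ (fun q hq y hy => ?_) (fun y hy => ?_) fun q hq q' hq' y hy hy' => ?_
    · obtain rfl : E.base q = x := by simpa [mem_newGroup] using hq
      refine ⟨?_, rfl⟩
      rw [source_eq]
      exact (S.mem_nextθ_target.1 hy).1
    · obtain ⟨q, hq, hyq⟩ := S.exists_mem_nextθ_target (x := x) (y := y)
        (by rwa [← source_eq])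
      exact ⟨q, by simpa [mem_newGroup] using hq, hyq⟩
    · simp only [Finset.mem_filter, Finset.mem_univ, true_and] at hq hq'
      exact S.next.target_unique (E.newGroup_mem x) hq hq' hy hy'

theorem rep_next_comp_phi : S.next.rep.comp E.phi = S.rep := by
  refine RingQuot.ringQuot_ext' ℂ _ _ (FreeAlgebra.hom_ext (funext fun g => ?_))
  change S.next.rep (E.phi (E.toLPA (E.gen g))) = S.rep (E.toLPA (E.gen g))
  rw [phi_toLPA_gen, rep_next_phiGen, rep_toLPA_gen]

theorem rep_seq_trans {m n : ℕ} (h : m ≤ n) (a : LPA (E.seq m)) :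
    (S.seq n).rep (E.trans m n h a) = (S.seq m).rep a := by
  induction h with
  | refl => rw [trans_self]; rfl
  | step h ih =>
    rw [trans_succ _ _ _ h, ← ih]
    exact DFunLike.congr_fun (S.seq _).rep_next_comp_phi _

/-- The representation of `L^{ab}(E, C)` on the functions on the space. -/
def labRep : E.Lab →ₐ[ℂ] Module.End ℂ (Ω → ℂ) :=
  DirectLimit.Algebra.lift _ _ _ (fun n => (S.seq n).rep) fun _ _ h a => S.rep_seq_trans h a

theorem labRep_labV (n : ℕ) (v : (E.seq n).Vert) :
    S.labRep (E.labV n v) = indOp ((S.seq n).dom v) := (S.seq n).rep_vtx v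

theorem labRep_labE (n : ℕ) (x : (E.seq n).Edge) :
    S.labRep (E.labE n x) = compOp ((S.seq n).θ x).symm := (S.seq n).rep_edg x

theorem labRep_labG (n : ℕ) (x : (E.seq n).Edge) :
    S.labRep (E.labG n x) = compOp ((S.seq n).θ x) := (S.seq n).rep_gho x

end HomeoSystem

/-! ### Projections of `B_∞` and the two conjugations -/

variable (E : BipSepGraph.{u})

/-- The vertex `v` of `E_n` as a projection in `B_∞`. -/
def vertProjSeq (n : ℕ) (v : (E.seq n).Vert) : E.Binf := ⟨E.labV n v, E.labV_mem n v⟩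

/-- The projection `x x^*` in `B_∞`, for an edge `x` of `E_n`. -/
def edgeProjSeq (n : ℕ) (x : (E.seq n).Edge) : E.Binf :=
  ⟨E.labE n x * E.labG n x, E.labE_mul_labG_mem n x⟩

/-- The map `b ↦ x^* b x` on `B_∞`, for an edge `x` of `E_n`. -/
def conjSeq (n : ℕ) (x : (E.seq n).Edge) (b : E.Binf) : E.Binf :=
  ⟨E.labG n x * b.1 * E.labE n x, E.labG_conj_mem n x b.2⟩

theorem sum_labV (n : ℕ) : ∑ v, E.labV n v = 1 := by
  simp only [labV, ← map_sum, sum_vtx, map_one]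

theorem labV_mul_self (n : ℕ) (v : (E.seq n).Vert) : E.labV n v * E.labV n v = E.labV n v := by
  rw [labV, ← map_mul, vtx_mul_self]

open Classical in
theorem sum_labE_mul_labG (n : ℕ) {v : (E.seq n).V0} {X : Set (E.seq n).Edge}
    (hX : X ∈ (E.seq n).C v) :
    ∑ x with x ∈ X, E.labE n x * E.labG n x = E.labV n (.inl v) := by
  simp only [labE, labG, labV, ← map_mul, ← map_sum, sum_edg_mul_gho _ hX]

theorem labE_mul_labG_of_ne (n : ℕ) {x y : (E.seq n).Edge} (h : (E.seq n).s x ≠ (E.seq n).s y) :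
    E.labE n x * E.labG n y = 0 := by
  rw [labE, labG, ← map_mul, edg_mul_gho_of_ne _ h, map_zero]

theorem labE_mul_labG_mul_labE (n : ℕ) (x : (E.seq n).Edge) :
    E.labE n x * E.labG n x * E.labE n x = E.labE n x := by
  rw [mul_assoc, labG_mul_labE_self, labE_mul_source]

theorem sum_vertProjSeq (n : ℕ) : ∑ v, E.vertProjSeq n v = 1 :=
  Subtype.ext (by simpa [vertProjSeq] using E.sum_labV n)

theorem vertProjSeq_mul_self (n : ℕ) (v : (E.seq n).Vert) :
    E.vertProjSeq n v * E.vertProjSeq n v = E.vertProjSeq n v :=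
  Subtype.ext (E.labV_mul_self n v)

theorem vertProjSeq_mul (n : ℕ) {v v' : (E.seq n).Vert} (h : v ≠ v') :
    E.vertProjSeq n v * E.vertProjSeq n v' = 0 :=
  Subtype.ext (E.labV_mul_labV n h)

theorem edgeProjSeq_mul_self (n : ℕ) (x : (E.seq n).Edge) :
    E.edgeProjSeq n x * E.edgeProjSeq n x = E.edgeProjSeq n x :=
  Subtype.ext (by
    change E.labE n x * E.labG n x * (E.labE n x * E.labG n x) = E.labE n x * E.labG n x
    rw [← mul_assoc, labE_mul_labG_mul_labE])

theorem range_mul_edgeProjSeq (n : ℕ) (x : (E.seq n).Edge) :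
    E.vertProjSeq n (.inl ((E.seq n).r x)) * E.edgeProjSeq n x = E.edgeProjSeq n x :=
  Subtype.ext (by
    change E.labV n _ * (E.labE n x * E.labG n x) = E.labE n x * E.labG n x
    rw [← mul_assoc, range_mul_labE])

theorem edgeProjSeq_mul (n : ℕ) {v : (E.seq n).V0} {X : Set (E.seq n).Edge}
    (hX : X ∈ (E.seq n).C v) {x y : (E.seq n).Edge} (hx : x ∈ X) (hy : y ∈ X) (h : x ≠ y) :
    E.edgeProjSeq n x * E.edgeProjSeq n y = 0 :=
  Subtype.ext (by
    change E.labE n x * E.labG n x * (E.labE n y * E.labG n y) = 0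
    rw [mul_assoc, ← mul_assoc (E.labG n x), E.labG_mul_labE n hX hx hy h, zero_mul, mul_zero])

open Classical in
theorem sum_edgeProjSeq (n : ℕ) {v : (E.seq n).V0} {X : Set (E.seq n).Edge}
    (hX : X ∈ (E.seq n).C v) :
    ∑ x with x ∈ X, E.edgeProjSeq n x = E.vertProjSeq n (.inl v) :=
  Subtype.ext (by simpa [edgeProjSeq, vertProjSeq] using E.sum_labE_mul_labG n hX)

open Classical in
-- In `φ(x) φ(x^*)` the cross terms vanish, leaving the vertices `z^* z` for `z ∈ X(x)`. A character
-- that is 1 on `x x^*` thus selects a new vertex involving `x`.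
theorem edgeProjSeq_eq_sum (n : ℕ) (x : (E.seq n).Edge) :
    E.edgeProjSeq n x =
      ∑ q with E.baseSeq n q = x, E.vertProjSeq (n + 1) (.inr ((E.seq (n + 1)).s q)) := by
  refine Subtype.ext ?_
  rw [AddSubmonoidClass.coe_finsetSum]
  change E.labE n x * E.labG n x = _
  rw [labE, labG, ← map_mul, toLab_phi, map_mul, edg, gho, phi_toLPA_gen, phi_toLPA_gen,
    phi_edge_mul_ghost, map_sum]
  rfl

/-- The inner product `x^* x = s(x)` commutes with `a` and is absorbed by `x`. -/
theorem labE_conj_mul (n : ℕ) (x : (E.seq n).Edge) {a b : E.Lab} (ha : a ∈ E.Binf) :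
    E.labE n x * (a * b) * E.labG n x =
      (E.labE n x * a * E.labG n x) * (E.labE n x * b * E.labG n x) := by
  have hc := E.Binf_comm ha (E.labV_mem n (.inr ((E.seq n).s x)))
  have : (E.labE n x * a * E.labG n x) * (E.labE n x * b * E.labG n x) =
      E.labE n x * (a * (E.labG n x * E.labE n x)) * b * E.labG n x := by
    simp only [mul_assoc]
  rw [this, labG_mul_labE_self, hc]
  calc E.labE n x * (a * b) * E.labG n x
      = E.labE n x * E.labV n (.inr ((E.seq n).s x)) * (a * b) * E.labG n x := by
        rw [labE_mul_source]
    _ = _ := by simp only [mul_assoc]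

/-- The algebra `B_∞` is invariant under `b ↦ x b x^*`. -/
theorem labE_conj_mem (n : ℕ) (x : (E.seq n).Edge) {b : E.Lab} (hb : b ∈ E.Binf) :
    E.labE n x * b * E.labG n x ∈ E.Binf := by
  rw [Binf_eq_adjoin] at hb
  induction hb using Algebra.adjoin_induction with
  | mem b hb =>
    obtain ⟨m, v, rfl⟩ := Set.mem_iUnion.1 hb
    exact (E.conj_labV n m x v).1
  | algebraMap c =>
    rw [Algebra.algebraMap_eq_smul_one, mul_smul_comm, mul_one, smul_mul_assoc]
    exact Subalgebra.smul_mem _ (E.labE_mul_labG_mem _ _) c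
  | add a b ha hb iha ihb =>
    rw [mul_add, add_mul]
    exact add_mem iha ihb
  | mul a b ha hb iha ihb =>
    rw [← Binf_eq_adjoin] at ha
    rw [E.labE_conj_mul n x ha]
    exact mul_mem iha ihb

/-- The map `b ↦ x b x^*` on `B_∞`, for an edge `x` of `E`. -/
def coconj (x : E.Edge) : E.Binf →ₗ[ℂ] E.Binf where
  toFun b := ⟨E.edgeLab x * b.1 * E.ghostLab x, E.labE_conj_mem 0 x b.2⟩
  map_add' a b := Subtype.ext (by simp [mul_add, add_mul])
  map_smul' c b := Subtype.ext (by simp)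

theorem coconj_mul (x : E.Edge) (a b : E.Binf) :
    E.coconj x (a * b) = E.coconj x a * E.coconj x b :=
  Subtype.ext (E.labE_conj_mul 0 x a.2)

theorem coconj_one (x : E.Edge) : E.coconj x 1 = E.edgeProj x :=
  Subtype.ext (congrArg (· * E.ghostLab x) (mul_one (E.edgeLab x)))

/-- The two conjugations are inverse only up to compression by a projection; a character equal to 1
on that projection does not see the compression. -/
theorem coconj_conj (x : E.Edge) (b : E.Binf) :
    E.coconj x (E.conj x b) = E.edgeProj x * b * E.edgeProj x :=
  Subtype.ext (by
    change E.edgeLab x * (E.ghostLab x * b.1 * E.edgeLab x) * E.ghostLab x =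
      E.edgeLab x * E.ghostLab x * b.1 * (E.edgeLab x * E.ghostLab x)
    simp only [mul_assoc])

theorem conj_coconj (x : E.Edge) (b : E.Binf) :
    E.conj x (E.coconj x b) = E.vertProj (.inr (E.s x)) * b * E.vertProj (.inr (E.s x)) :=
  Subtype.ext (by
    change E.ghostLab x * (E.edgeLab x * b.1 * E.ghostLab x) * E.edgeLab x =
      (E.vertProj (.inr (E.s x))).1 * b.1 * (E.vertProj (.inr (E.s x))).1
    rw [← ghostLab_mul_edgeLab]
    simp only [mul_assoc])

theorem coconj_vertProj (x : E.Edge) : E.coconj x (E.vertProj (.inr (E.s x))) = E.edgeProj x :=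
  Subtype.ext (congrArg (· * E.ghostLab x) (E.labE_mul_source 0 x))

/-! ### Characters of `B_∞`: idempotents and compactness -/

namespace Omega

variable {E}

theorem eval_mul (χ : E.Omega) (a b : E.Binf) : χ.eval (a * b) = χ.eval a * χ.eval b :=
  map_mul (AlgHom.toRingHom χ) a b

theorem eval_add (χ : E.Omega) (a b : E.Binf) : χ.eval (a + b) = χ.eval a + χ.eval b :=
  map_add (AlgHom.toRingHom χ) a b

theorem eval_zero (χ : E.Omega) : χ.eval 0 = 0 := map_zero (AlgHom.toRingHom χ)

theorem eval_one (χ : E.Omega) : χ.eval 1 = 1 := map_one (AlgHom.toRingHom χ)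

theorem eval_sum (χ : E.Omega) {ι : Type*} (I : Finset ι) (b : ι → E.Binf) :
    χ.eval (∑ i ∈ I, b i) = ∑ i ∈ I, χ.eval (b i) := map_sum (AlgHom.toRingHom χ) b I

theorem eval_algebraMap (χ : E.Omega) (c : ℂ) : χ.eval (algebraMap ℂ E.Binf c) = c :=
  AlgHom.commutes (A := E.Binf) (B := ℂ) χ c

theorem eval_injective : Function.Injective (fun (χ : E.Omega) b => χ.eval b) := fun _ _ h =>
  AlgHom.ext fun b => congrFun h b

theorem ext {χ χ' : E.Omega} (h : ∀ b, χ.eval b = χ'.eval b) : χ = χ' :=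
  eval_injective (funext h)

theorem isEmbedding_eval : Topology.IsEmbedding (fun (χ : E.Omega) b => χ.eval b) :=
  ⟨⟨rfl⟩, eval_injective⟩

theorem continuous_eval (b : E.Binf) : Continuous fun χ : E.Omega => χ.eval b :=
  (continuous_apply b).comp isEmbedding_eval.continuous

theorem continuous_iff {Y : Type*} [TopologicalSpace Y] {f : Y → E.Omega} :
    Continuous f ↔ ∀ b, Continuous fun y => (f y).eval b := by
  rw [isEmbedding_eval.continuous_iff, continuous_pi_iff]
  rfl

theorem eval_eq_zero_or_one (χ : E.Omega) {e : E.Binf} (he : e * e = e) :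
    χ.eval e = 0 ∨ χ.eval e = 1 := by
  have h : χ.eval e * χ.eval e = χ.eval e := by rw [← eval_mul, he]
  by_cases h0 : χ.eval e = 0
  · exact .inl h0
  · exact .inr (mul_right_cancel₀ h0 (h.trans (one_mul _).symm))

/-- On an idempotent, being 1 (a closed condition) is the same as being nonzero (an open one). -/
theorem isClopen_eval_eq_one {e : E.Binf} (he : e * e = e) :
    IsClopen {χ : E.Omega | χ.eval e = 1} := by
  refine ⟨isClosed_eq (continuous_eval e) continuous_const, ?_⟩
  have : {χ : E.Omega | χ.eval e = 1} = {χ | χ.eval e ≠ 0} := by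
    ext χ
    rcases χ.eval_eq_zero_or_one he with h | h <;> simp [h]
  rw [this]
  exact isOpen_ne_fun (continuous_eval e) continuous_const

theorem not_both_one (χ : E.Omega) {a b : E.Binf} (h : a * b = 0) (ha : χ.eval a = 1)
    (hb : χ.eval b = 1) : False := by
  have := χ.eval_mul a b
  rw [h, eval_zero, ha, hb] at this
  norm_num at this

theorem exists_eval_eq_one (χ : E.Omega) {ι : Type*} (I : Finset ι) (e : ι → E.Binf)
    (he : ∀ i ∈ I, e i * e i = e i) (h : χ.eval (∑ i ∈ I, e i) = 1) :
    ∃ i ∈ I, χ.eval (e i) = 1 := by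
  rw [eval_sum] at h
  obtain ⟨i, hi, hne⟩ := Finset.exists_ne_zero_of_sum_ne_zero (h ▸ one_ne_zero)
  exact ⟨i, hi, (χ.eval_eq_zero_or_one (he i hi)).resolve_left hne⟩

theorem eval_eq_one_of_mul_eq (χ : E.Omega) {a b : E.Binf} (h : a * b = b) (hb : χ.eval b = 1) :
    χ.eval a = 1 := by
  have := χ.eval_mul a b
  rwa [h, hb, mul_one, eq_comm] at this

theorem exists_vertProjSeq (χ : E.Omega) (n : ℕ) : ∃ v, χ.eval (E.vertProjSeq n v) = 1 := by
  obtain ⟨v, -, h⟩ := χ.exists_eval_eq_one Finset.univ (E.vertProjSeq n)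
    (fun v _ => E.vertProjSeq_mul_self n v) (by rw [sum_vertProjSeq, eval_one])
  exact ⟨v, h⟩

theorem vertProjSeq_unique (χ : E.Omega) {n : ℕ} {v v' : (E.seq n).Vert}
    (h : χ.eval (E.vertProjSeq n v) = 1) (h' : χ.eval (E.vertProjSeq n v') = 1) : v = v' := by
  by_contra hne
  exact χ.not_both_one (E.vertProjSeq_mul n hne) h h'

theorem Binf_induction {P : E.Binf → Prop} (hv : ∀ n v, P (E.vertProjSeq n v))
    (hc : ∀ c, P (algebraMap ℂ E.Binf c)) (hadd : ∀ a b, P a → P b → P (a + b))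
    (hmul : ∀ a b, P a → P b → P (a * b)) (b : E.Binf) : P b := by
  -- `P` is a predicate on the subtype, so membership in `B_∞` is carried along existentially
  -- through the induction in the ambient algebra.
  have key : ∀ b (hb : b ∈ Algebra.adjoin ℂ (⋃ n, Set.range (E.labV n))),
      ∃ hb' : b ∈ E.Binf, P ⟨b, hb'⟩ := by
    intro b hb
    induction hb using Algebra.adjoin_induction with
    | mem b hb =>
      obtain ⟨m, v, rfl⟩ := Set.mem_iUnion.1 hb
      exact ⟨_, hv m v⟩
    | algebraMap c => exact ⟨_, hc c⟩
    | add a b _ _ iha ihb =>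
      obtain ⟨ha, ha'⟩ := iha
      obtain ⟨hb, hb'⟩ := ihb
      exact ⟨_, hadd _ _ ha' hb'⟩
    | mul a b _ _ iha ihb =>
      obtain ⟨ha, ha'⟩ := iha
      obtain ⟨hb, hb'⟩ := ihb
      exact ⟨_, hmul _ _ ha' hb'⟩
  exact (key b.1 (E.Binf_eq_adjoin ▸ b.2)).2

/-- No norm on `B_∞` is needed: the generators take only the values 0 and 1, and uniform bounds
survive sums and products. -/
theorem exists_bound (b : E.Binf) : ∃ M : ℝ, ∀ χ : E.Omega, ‖χ.eval b‖ ≤ M := by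
  induction b using Binf_induction with
  | hv n v =>
    refine ⟨1, fun χ => ?_⟩
    rcases χ.eval_eq_zero_or_one (E.vertProjSeq_mul_self n v) with h | h <;> simp [h]
  | hc c => exact ⟨‖c‖, fun χ => by rw [eval_algebraMap]⟩
  | hadd a b ha hb =>
    obtain ⟨M, hM⟩ := ha
    obtain ⟨N, hN⟩ := hb
    exact ⟨M + N, fun χ => by rw [eval_add]; exact norm_add_le_of_le (hM χ) (hN χ)⟩
  | hmul a b ha hb =>
    obtain ⟨M, hM⟩ := ha
    obtain ⟨N, hN⟩ := hb
    exact ⟨M * N, fun χ => by rw [eval_mul]; exact norm_mul_le_of_le (hM χ) (hN χ)⟩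

/-- Being a character is a family of equations, each involving finitely many coordinates of the
product. -/
theorem isClosed_range_eval : IsClosed (Set.range fun (χ : E.Omega) b => χ.eval b) := by
  have : (Set.range fun (χ : E.Omega) b => χ.eval b) =
      {g : E.Binf → ℂ | (∀ a b, g (a + b) = g a + g b) ∧ (∀ a b, g (a * b) = g a * g b) ∧
        ∀ c, g (algebraMap ℂ E.Binf c) = c} := by
    ext g
    constructor
    · rintro ⟨χ, rfl⟩
      exact ⟨χ.eval_add, χ.eval_mul, χ.eval_algebraMap⟩
    · rintro ⟨hadd, hmul, hc⟩
      have h1 : g 1 = 1 := by simpa using hc 1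
      have h0 : g 0 = 0 := by simpa using hc 0
      exact ⟨(⟨⟨⟨⟨g, h1⟩, hmul⟩, h0, hadd⟩, hc⟩ : E.Binf →ₐ[ℂ] ℂ), rfl⟩
  rw [this]
  simp only [Set.ofPred_and, Set.ofPred_forall]
  refine .inter ?_ (.inter ?_ ?_)
  · exact isClosed_iInter fun a => isClosed_iInter fun b =>
      isClosed_eq (by fun_prop) (by fun_prop)
  · exact isClosed_iInter fun a => isClosed_iInter fun b =>
      isClosed_eq (by fun_prop) (by fun_prop)
  · exact isClosed_iInter fun c => isClosed_eq (by fun_prop) (by fun_prop)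

instance : T2Space E.Omega := isEmbedding_eval.t2Space

instance : CompactSpace E.Omega := by
  choose M hM using exists_bound (E := E)
  rw [← isCompact_univ_iff, isEmbedding_eval.isCompact_iff, Set.image_univ]
  refine (isCompact_univ_pi fun b => isCompact_closedBall (0 : ℂ) (M b)).of_isClosed_subset
    isClosed_range_eval ?_
  rintro _ ⟨χ, rfl⟩ b -
  simpa using hM b χ

end Omega

/-! ### The spectrum is a dynamical system -/

/-- The inverse of `χ ↦ χ(x^* · x)`: a character `χ` with `χ(x x^*) = 1` goes to the character
`b ↦ χ(x b x^*)`. -/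
def omegaMapInv (x : E.Edge) (χ : E.Omega) (h : χ.eval (E.edgeProj x) = 1) : E.Omega :=
  AlgHom.ofLinearMap ((AlgHom.toLinearMap χ).comp (E.coconj x))
    (by
      change χ.eval (E.coconj x 1) = 1
      rw [coconj_one, h])
    (fun a b => by
      change χ.eval (E.coconj x (a * b)) = χ.eval (E.coconj x a) * χ.eval (E.coconj x b)
      rw [coconj_mul, Omega.eval_mul])

theorem omegaMapInv_eval (x : E.Edge) (χ : E.Omega) (h : χ.eval (E.edgeProj x) = 1)
    (b : E.Binf) : (E.omegaMapInv x χ h).eval b = χ.eval (E.coconj x b) := rfl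

theorem isHomeomorph_omegaSystem_θ (x : E.Edge) : IsHomeomorph (E.omegaSystem.θ x) := by
  have hd : IsClopen (E.omegaSystem.dom (.inr (E.s x))) :=
    Omega.isClopen_eval_eq_one (E.vertProjSeq_mul_self 0 _)
  have : CompactSpace (E.omegaSystem.dom (.inr (E.s x))) :=
    isCompact_iff_compactSpace.1 hd.isClosed.isCompact
  -- A continuous bijection from a compact space to a Hausdorff space is a homeomorphism, so
  -- continuity of the inverse comes for free.
  rw [isHomeomorph_iff_continuous_bijective]
  refine ⟨?_, ?_, ?_⟩
  · refine Continuous.subtype_mk (Omega.continuous_iff.2 fun b => ?_) _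
    exact (Omega.continuous_eval (E.conj x b)).comp continuous_subtype_val
  · rintro ⟨χ, hχ⟩ ⟨χ', hχ'⟩ h
    have h' : E.omegaMap x χ hχ = E.omegaMap x χ' hχ' := congrArg Subtype.val h
    refine Subtype.ext (Omega.ext fun b => ?_)
    -- Testing on `x b x^*` recovers `χ(s(x) b s(x)) = χ(b)`.
    have hb := congrArg (fun ψ : E.Omega => ψ.eval (E.coconj x b)) h'
    change χ.eval _ = 1 at hχ
    change χ'.eval _ = 1 at hχ'
    simpa only [omegaMap_eval, conj_coconj, Omega.eval_mul, hχ, hχ', one_mul, mul_one] using hb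
  · rintro ⟨χ, hχ⟩
    change χ.eval _ = 1 at hχ
    refine ⟨⟨E.omegaMapInv x χ hχ, ?_⟩, Subtype.ext (Omega.ext fun b => ?_)⟩
    · change (E.omegaMapInv x χ hχ).eval _ = 1
      rw [omegaMapInv_eval, coconj_vertProj, hχ]
    · change (E.omegaMapInv x χ hχ).eval (E.conj x b) = χ.eval b
      rw [omegaMapInv_eval, coconj_conj, Omega.eval_mul, Omega.eval_mul, hχ, one_mul, mul_one]

theorem isDynSystem_omegaSystem : IsDynSystem E.omegaSystem where
  compactSpace := inferInstance
  t2Space := inferInstance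
  isClopen_dom v := Omega.isClopen_eval_eq_one (E.vertProjSeq_mul_self 0 v)
  iUnion_dom := by
    refine Set.eq_univ_of_forall fun χ => ?_
    obtain ⟨v, hv⟩ := χ.exists_vertProjSeq 0
    exact Set.mem_iUnion.2 ⟨v, hv⟩
  disjoint_dom v v' h := Set.disjoint_left.2 fun χ hv hv' =>
    h (χ.vertProjSeq_unique (n := 0) hv hv')
  isClopen_H x := Omega.isClopen_eval_eq_one (E.edgeProjSeq_mul_self 0 x)
  H_subset x χ h := χ.eval_eq_one_of_mul_eq (E.range_mul_edgeProjSeq 0 x) h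
  iUnion_H v X hX := by
    classical
    refine Set.Subset.antisymm (Set.iUnion₂_subset fun x hx χ h => ?_) fun χ h => ?_
    · rw [← E.C_subset v X hX x hx]
      exact χ.eval_eq_one_of_mul_eq (E.range_mul_edgeProjSeq 0 x) h
    · obtain ⟨x, hx, hx'⟩ := χ.exists_eval_eq_one _ _
        (fun x _ => E.edgeProjSeq_mul_self 0 x)
        ((congrArg χ.eval (E.sum_edgeProjSeq 0 (v := v) hX)).trans h)
      exact Set.mem_iUnion₂.2 ⟨x, (Finset.mem_filter.1 hx).2, hx'⟩
  disjoint_H v X hX x hx y hy h := Set.disjoint_left.2 fun χ h1 h2 =>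
    χ.not_both_one (E.edgeProjSeq_mul 0 (v := v) hX hx hy h) h1 h2
  isHomeomorph_θ := E.isHomeomorph_omegaSystem_θ

end BipSepGraph

end

/-! ### From homeomorphisms of clopen sets to partial homeomorphisms -/

noncomputable section

/-- A homeomorphism between open subsets of a space as a partial homeomorphism. -/
def Homeomorph.toOpenPartialHomeomorphOfOpen {Ω : Type*} [TopologicalSpace Ω] {A B : Set Ω}
    (h : A ≃ₜ B) (hA : IsOpen A) (hB : IsOpen B) : OpenPartialHomeomorph Ω Ω := by
  classical
  exact
  -- Outside `A` and `B` the identity serves only as a default value.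
  { toFun := fun y => if hy : y ∈ A then h ⟨y, hy⟩ else y
    invFun := fun y => if hy : y ∈ B then h.symm ⟨y, hy⟩ else y
    source := A
    target := B
    map_source' := fun y hy => by simp [hy]
    map_target' := fun y hy => by simp [hy]
    left_inv' := fun y hy => by simp [hy]
    right_inv' := fun y hy => by simp [hy]
    open_source := hA
    open_target := hB
    continuousOn_toFun := by
      rw [continuousOn_iff_continuous_domRestrict]
      convert continuous_subtype_val.comp h.continuous using 1
      ext y
      simp
    continuousOn_invFun := by
      rw [continuousOn_iff_continuous_domRestrict]
      convert continuous_subtype_val.comp h.symm.continuous using 1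
      ext y
      simp }

theorem Homeomorph.toOpenPartialHomeomorphOfOpen_apply {Ω : Type*} [TopologicalSpace Ω]
    {A B : Set Ω} (h : A ≃ₜ B) (hA : IsOpen A) (hB : IsOpen B) (y : A) :
    h.toOpenPartialHomeomorphOfOpen hA hB y = h y := by
  simp [toOpenPartialHomeomorphOfOpen]

namespace BipSepGraph

namespace HomeoSystem

variable {E : BipSepGraph.{u}} {Ω : Type w} [TopologicalSpace Ω]

/-- The dynamical system of partial homeomorphisms attached to a dynamical system. -/
def ofDynData (S : DynData E Ω) (hS : IsDynSystem S) : HomeoSystem E Ω where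
  dom := S.dom
  θ x := ((hS.isHomeomorph_θ x).homeomorph).toOpenPartialHomeomorphOfOpen
    (hS.isClopen_dom _).isOpen (hS.isClopen_H x).isOpen
  isClopen_dom := hS.isClopen_dom
  exists_mem_dom y := Set.mem_iUnion.1 (hS.iUnion_dom ▸ Set.mem_univ y)
  dom_unique {v v' y} h h' := by
    by_contra hne
    exact Set.disjoint_left.1 (hS.disjoint_dom v v' hne) h h'
  source_eq _ := rfl
  isClopen_target := hS.isClopen_H
  target_subset := hS.H_subset
  exists_mem_target {v X y} hX hy := by
    rw [← hS.iUnion_H v X hX] at hy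
    obtain ⟨x, hx, hy⟩ := Set.mem_iUnion₂.1 hy
    exact ⟨x, hx, hy⟩
  target_unique {v X x x' y} hX hx hx' h h' := by
    by_contra hne
    exact Set.disjoint_left.1 (hS.disjoint_H v X hX x hx x' hx' hne) h h'

theorem ofDynData_θ (S : DynData E Ω) (hS : IsDynSystem S) (x : E.Edge)
    (y : S.dom (.inr (E.s x))) : (ofDynData S hS).θ x y = S.θ x y :=
  Homeomorph.toOpenPartialHomeomorphOfOpen_apply _ _ _ y

variable (S : HomeoSystem E Ω)

/-! ### Existence: the character attached to a point -/

/-- The elements of `B_∞` act on functions as multiplication operators. -/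
theorem labRep_eq_mul (b : E.Binf) (f : Ω → ℂ) :
    S.labRep b.1 f = S.labRep b.1 1 * f := by
  classical
  induction b using Omega.Binf_induction generalizing f with
  | hv n v =>
    change S.labRep (E.labV n v) f = S.labRep (E.labV n v) 1 * f
    rw [labRep_labV]
    ext y
    simp [indOp_apply]
  | hc c =>
    change S.labRep (algebraMap ℂ E.Lab c) f = S.labRep (algebraMap ℂ E.Lab c) 1 * f
    rw [AlgHom.commutes]
    ext y
    simp [Module.algebraMap_end_apply]
  | hadd a b ha hb =>
    change S.labRep (a.1 + b.1) f = S.labRep (a.1 + b.1) 1 * f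
    simp only [map_add, LinearMap.add_apply, add_mul]
    rw [ha, hb]
  | hmul a b ha hb =>
    change S.labRep (a.1 * b.1) f = S.labRep (a.1 * b.1) 1 * f
    simp only [map_mul, Module.End.mul_apply]
    rw [ha, hb, ha (S.labRep b.1 1), mul_assoc]

/-- These functions are polynomials in indicators of clopen sets. This is what makes the map into
the spectrum continuous. -/
theorem continuous_labRep_one (b : E.Binf) : Continuous (S.labRep b.1 1) := by
  induction b using Omega.Binf_induction with
  | hv n v =>
    change Continuous (S.labRep (E.labV n v) 1)
    rw [labRep_labV]
    exact ((S.seq n).isClopen_dom v).continuous_indicator continuous_one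
  | hc c =>
    change Continuous (S.labRep (algebraMap ℂ E.Lab c) 1)
    rw [AlgHom.commutes, Module.algebraMap_end_apply]
    exact continuous_const.smul continuous_one
  | hadd a b ha hb =>
    change Continuous (S.labRep (a.1 + b.1) 1)
    rw [map_add]
    exact ha.add hb
  | hmul a b ha hb =>
    change Continuous (S.labRep (a.1 * b.1) 1)
    rw [map_mul, Module.End.mul_apply, labRep_eq_mul]
    exact ha.mul hb

/-- The character of `B_∞` attached to a point of a dynamical system. -/
def toOmega (y : Ω) : E.Omega :=
  AlgHom.ofLinearMap
    { toFun := fun b : E.Binf => S.labRep b.1 1 y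
      map_add' := fun a b => by simp
      map_smul' := fun c b => by simp }
    (by simp)
    (fun a b => by
      change S.labRep (a.1 * b.1) 1 y = S.labRep a.1 1 y * S.labRep b.1 1 y
      rw [map_mul, Module.End.mul_apply, labRep_eq_mul, Pi.mul_apply])

theorem toOmega_eval (y : Ω) (b : E.Binf) : (S.toOmega y).eval b = S.labRep b.1 1 y := rfl

theorem continuous_toOmega : Continuous S.toOmega :=
  Omega.continuous_iff.2 S.continuous_labRep_one

theorem labRep_vertProj (v : E.Vert) : S.labRep (E.vertProj v).1 = indOp (S.dom v) :=
  S.labRep_labV 0 v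

theorem labRep_edgeLab (x : E.Edge) : S.labRep (E.edgeLab x) = compOp (S.θ x).symm :=
  S.labRep_labE 0 x

theorem labRep_ghostLab (x : E.Edge) : S.labRep (E.ghostLab x) = compOp (S.θ x) :=
  S.labRep_labG 0 x

theorem toOmega_vertProj {v : E.Vert} {y : Ω} (hy : y ∈ S.dom v) :
    (S.toOmega y).eval (E.vertProj v) = 1 := by
  rw [toOmega_eval]
  rw [labRep_vertProj]
  exact Set.indicator_of_mem hy 1

theorem toOmega_edgeProj {x : E.Edge} {y : Ω} (hy : y ∈ (S.θ x).target) :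
    (S.toOmega y).eval (E.edgeProj x) = 1 := by
  rw [toOmega_eval]
  change S.labRep (E.edgeLab x * E.ghostLab x) 1 y = 1
  rw [map_mul, labRep_edgeLab, labRep_ghostLab, compOp_symm_mul]
  exact Set.indicator_of_mem hy 1

/-- Applying `x^* b x` to 1 and evaluating at `y` gives `b · 1` times `x · 1`, both at `θ_x y`; the
second factor is 1 because `θ_x y ∈ H_x`. -/
theorem toOmega_θ {x : E.Edge} {y : Ω} (hy : y ∈ S.dom (.inr (E.s x))) (b : E.Binf) :
    (S.toOmega (S.θ x y)).eval b = (S.toOmega y).eval (E.conj x b) := by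
  classical
  rw [toOmega_eval, toOmega_eval, conj_val]
  have hs : y ∈ (S.θ x).source := by rwa [source_eq]
  rw [map_mul, map_mul, labRep_edgeLab, labRep_ghostLab, Module.End.mul_apply, Module.End.mul_apply,
    S.labRep_eq_mul b (compOp (S.θ x).symm 1)]
  rw [compOp_apply, if_pos hs, Pi.mul_apply, compOp_apply,
    OpenPartialHomeomorph.symm_source, if_pos ((S.θ x).map_source hs)]
  simp

/-! ### Uniqueness: equivariance propagates to every level -/

/-- The map `f` to `Ω(E, C)` is equivariant with respect to a dynamical system of `(E_n, C^n)`
and the canonical action of `(E_n, C^n)` on `Ω(E, C)`. -/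
structure Intertwines (n : ℕ) (T : HomeoSystem (E.seq n) Ω) (f : Ω → E.Omega) : Prop where
  dom : ∀ {v y}, y ∈ T.dom v → (f y).eval (E.vertProjSeq n v) = 1
  target : ∀ {x y}, y ∈ (T.θ x).target → (f y).eval (E.edgeProjSeq n x) = 1
  θ : ∀ {x y}, y ∈ T.dom (.inr ((E.seq n).s x)) → ∀ b,
    (f (T.θ x y)).eval b = (f y).eval (E.conjSeq n x b)

variable {S}

/-- The character `f y` is 1 on every `x_i x_i^*`, and each of these is a sum of new vertices
involving `x_i`. A character is 1 on only one vertex of `E_{n+1}`, so that vertex involves all the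
`x_i` and is `p`. -/
theorem Intertwines.next_inr {n : ℕ} {T : HomeoSystem (E.seq n) Ω} {f : Ω → E.Omega}
    (h : Intertwines n T f) {p : (E.seq (n + 1)).V1} {y : Ω} (hy : y ∈ T.nextDom (.inr p)) :
    (f y).eval (E.vertProjSeq (n + 1) (.inr p)) = 1 := by
  classical
  have hX : ∀ X : (E.seq n).C (Sigma.fst p), ∃ q : (E.seq (n + 1)).Edge,
      E.baseSeq n q = (Sigma.snd p).1 X ∧
      (f y).eval (E.vertProjSeq (n + 1) (.inr ((E.seq (n + 1)).s q))) = 1 := by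
    intro X
    have h1 := h.target (Set.mem_iInter.1 hy X)
    rw [edgeProjSeq_eq_sum] at h1
    obtain ⟨q, hq, hq1⟩ := (f y).exists_eval_eq_one _ _
      (fun q _ => E.vertProjSeq_mul_self (n + 1) _) h1
    exact ⟨q, (Finset.mem_filter.1 hq).2, hq1⟩
  -- Some group `X₀` must exist to produce a first candidate vertex `s(q₀)`; the other groups are
  -- then compared with it.
  obtain ⟨x₀, hx₀⟩ := (E.seq n).r_surj (Sigma.fst p)
  obtain ⟨X₀, hX₀, -⟩ := (E.seq n).C_cover x₀
  rw [hx₀] at hX₀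
  obtain ⟨q₀, hb₀, hq₀⟩ := hX ⟨X₀, hX₀⟩
  suffices hp : (E.seq (n + 1)).s q₀ = p by rwa [hp] at hq₀
  have hroot : (E.seq n).root ((E.seq (n + 1)).s q₀) = Sigma.fst p := by
    refine ((E.seq n).root_s q₀).trans ((congrArg (E.seq n).r hb₀).trans ?_)
    exact (E.seq n).C_subset _ _ hX₀ _ ((Sigma.snd p).2 ⟨X₀, hX₀⟩)
  have hc : ∀ X : (E.seq n).C (Sigma.fst p), ∃ q : (E.seq (n + 1)).Edge,
      E.baseSeq n q = (Sigma.snd p).1 X ∧ (E.seq (n + 1)).s q = (E.seq (n + 1)).s q₀ := by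
    intro X
    obtain ⟨q, hq, hq1⟩ := hX X
    exact ⟨q, hq, Sum.inr_injective ((f y).vertProjSeq_unique hq1 hq₀)⟩
  generalize (E.seq (n + 1)).s q₀ = p' at hroot hc
  obtain ⟨u, c, hcm⟩ := p
  obtain ⟨u', c', hcm'⟩ := p'
  obtain rfl : u' = u := hroot
  have : c' = c := by
    funext X
    obtain ⟨⟨p'', Y⟩, hq, hs⟩ := hc X
    obtain rfl : p'' = ⟨u', c', hcm'⟩ := hs
    have hY : c' Y = c X := hq
    -- The group indexing the new edge is not known in advance; it is `X` because both contain the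
    -- same edge.
    have : Y = X := Subtype.ext
      ((E.seq n).C_disjoint _ _ Y.2 _ X.2 (c' Y) (hcm' Y) (hY ▸ hcm X))
    rw [← hY, this]
  subst this
  rfl

/-- For an edge `q` of `E_{n+1}` that comes from `x`, `x^* s(q) x = q q^*`. -/
theorem conjSeq_source (n : ℕ) (q : (E.seq (n + 1)).Edge) :
    E.conjSeq n (E.baseSeq n q) (E.vertProjSeq (n + 1) (.inr ((E.seq (n + 1)).s q))) =
      E.edgeProjSeq (n + 1) q := by
  classical
  refine Subtype.ext ?_
  change E.labG n (E.baseSeq n q) * E.labV (n + 1) _ * E.labE n (E.baseSeq n q) =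
    E.labE (n + 1) q * E.labG (n + 1) q
  -- In the limit `x^* = ∑ q'` and `x = ∑ q'^*` over the edges `q'` coming from `x`. Their sources
  -- are distinct, so the vertex `s(q)` kills every term but `q`.
  rw [labE_eq, labG_eq, Finset.sum_mul, Finset.sum_eq_single_of_mem q (by simp),
    labE_mul_source, Finset.mul_sum, Finset.sum_eq_single_of_mem q (by simp)]
  · intro q' hq' hne
    refine E.labE_mul_labG_of_ne (n + 1) ?_
    exact E.source_ne_of_base n (Finset.mem_filter.1 hq').2.symm hne.symm
  · intro q' hq' hne
    have := E.source_ne_of_base n (Finset.mem_filter.1 hq').2 hne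
    rw [← labE_mul_source, mul_assoc, labV_mul_labV _ _ (by simpa using this), mul_zero]

/-- Both `x^* q^*` and `q x` collapse to `q q^*`, by distinctness of the sources over `x`. Thus
conjugation by `q` undoes conjugation by its base edge up to compression, just as `q` acts by an
inverse. -/
theorem conjSeq_conjSeq (n : ℕ) (q : (E.seq (n + 1)).Edge) (b : E.Binf) :
    E.conjSeq n (E.baseSeq n q) (E.conjSeq (n + 1) q b) =
      E.edgeProjSeq (n + 1) q * b * E.edgeProjSeq (n + 1) q := by
  classical
  have h1 : E.labG n (E.baseSeq n q) * E.labG (n + 1) q =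
      E.labE (n + 1) q * E.labG (n + 1) q := by
    rw [labG_eq, Finset.sum_mul, Finset.sum_eq_single_of_mem q (by simp)]
    intro q' hq' hne
    exact E.labE_mul_labG_of_ne (n + 1) (E.source_ne_of_base n (Finset.mem_filter.1 hq').2 hne)
  have h2 : E.labE (n + 1) q * E.labE n (E.baseSeq n q) =
      E.labE (n + 1) q * E.labG (n + 1) q := by
    rw [E.labE_eq n, Finset.mul_sum, Finset.sum_eq_single_of_mem q (by simp)]
    intro q' hq' hne
    exact E.labE_mul_labG_of_ne (n + 1)
      (E.source_ne_of_base n (Finset.mem_filter.1 hq').2.symm hne.symm)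
  refine Subtype.ext ?_
  change E.labG n (E.baseSeq n q) * (E.labG (n + 1) q * b.1 * E.labE (n + 1) q) *
    E.labE n (E.baseSeq n q) = E.labE (n + 1) q * E.labG (n + 1) q * b.1 *
      (E.labE (n + 1) q * E.labG (n + 1) q)
  rw [← mul_assoc, ← mul_assoc, h1, mul_assoc _ (E.labE (n + 1) q), h2]

/-- New vertices are handled by `Intertwines.next_inr`. For a new edge `q` over `x`, equivariance
under `θ_x` is read at `s(q)`, which gives `q q^*`, and then backwards at `θ_x⁻¹ y`, since `q` acts
by the inverse. -/
theorem Intertwines.next {n : ℕ} {T : HomeoSystem (E.seq n) Ω} {f : Ω → E.Omega}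
    (h : Intertwines n T f) : Intertwines (n + 1) T.next f where
  dom {v y} hy := by
    rcases v with w | p
    · rw [← h.dom (v := .inr w) (y := y) hy]
      exact congrArg (f y).eval (Subtype.ext (E.labV_inr n w).symm)
    · exact h.next_inr hy
  target {q y} hy := by
    obtain ⟨h1, h2⟩ := T.mem_nextθ_target.1 hy
    have h3 := h.next_inr h2
    rw [h.θ h1] at h3
    exact (congrArg (f y).eval (conjSeq_source n q)).symm.trans h3
  θ {q y} hy b := by
    have hy' : y ∈ (T.θ (E.baseSeq n q)).target := T.nextDom_subset_target q hy
    have hz : (T.θ (E.baseSeq n q)).symm y ∈ T.dom (.inr ((E.seq n).s (E.baseSeq n q))) := by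
      rw [← source_eq]
      exact (T.θ (E.baseSeq n q)).map_target hy'
    have hq := h.next_inr hy
    have key := h.θ hz
    rw [(T.θ (E.baseSeq n q)).right_inv hy'] at key
    change (f ((T.θ (E.baseSeq n q)).symm y)).eval b = _
    -- This value is that of `f y` at `s(q)`, and it removes the compression by `q q^*` in `key`.
    have he : (f ((T.θ (E.baseSeq n q)).symm y)).eval (E.edgeProjSeq (n + 1) q) = 1 := by
      rw [← conjSeq_source, ← key]
      exact hq
    rw [key, conjSeq_conjSeq, Omega.eval_mul, Omega.eval_mul, he, one_mul, mul_one]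

theorem Intertwines.seq {f : Ω → E.Omega} (h : Intertwines 0 S f) (n : ℕ) :
    Intertwines n (S.seq n) f := by
  induction n with
  | zero => exact h
  | succ n ih => exact ih.next

/-- At each level `y` lies in the set of some vertex, which fixes the value of the character on all
vertices of that level; the vertices of all levels generate `B_∞`. -/
theorem Intertwines.eq {f g : Ω → E.Omega} (hf : Intertwines 0 S f) (hg : Intertwines 0 S g) :
    f = g := by
  funext y
  refine Omega.ext fun b => ?_
  induction b using Omega.Binf_induction with
  | hv n v =>
    obtain ⟨v', hv'⟩ := (S.seq n).exists_mem_dom y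
    have hf' := (hf.seq n).dom hv'
    have hg' := (hg.seq n).dom hv'
    by_cases hv : v = v'
    · rw [hv, hf', hg']
    · have h0 : ∀ χ : E.Omega, χ.eval (E.vertProjSeq n v') = 1 →
          χ.eval (E.vertProjSeq n v) = 0 := fun χ h =>
        (χ.eval_eq_zero_or_one (E.vertProjSeq_mul_self n v)).resolve_right fun h1 =>
          hv (χ.vertProjSeq_unique h1 h)
      rw [h0 _ hf', h0 _ hg']
  | hc c => rw [Omega.eval_algebraMap, Omega.eval_algebraMap]
  | hadd a b ha hb => rw [Omega.eval_add, Omega.eval_add, ha, hb]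
  | hmul a b ha hb => rw [Omega.eval_mul, Omega.eval_mul, ha, hb]

theorem intertwines_of_isEquivariant {S : DynData E Ω} (hS : IsDynSystem S) {f : Ω → E.Omega}
    (hf : IsEquivariant S E.omegaSystem f) : Intertwines 0 (ofDynData S hS) f where
  dom hy := hf.map_dom _ hy
  target hy := hf.map_H _ hy
  θ {x y} hy b := by
    have h1 : (ofDynData S hS).θ x y = S.θ x ⟨y, hy⟩ := ofDynData_θ S hS x ⟨y, hy⟩
    exact congrArg (fun χ : E.Omega => χ.eval b) ((congrArg f h1).trans (hf.map_θ x ⟨y, hy⟩))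

theorem isEquivariant_toOmega {S : DynData E Ω} (hS : IsDynSystem S) :
    IsEquivariant S E.omegaSystem (ofDynData S hS).toOmega where
  map_dom _ _ hy := (ofDynData S hS).toOmega_vertProj hy
  map_H _ _ hy := (ofDynData S hS).toOmega_edgeProj hy
  map_θ x y := Omega.ext fun b => by
    rw [← ofDynData_θ S hS x y]
    exact (ofDynData S hS).toOmega_θ y.2 b

end HomeoSystem

end BipSepGraph

end

theorem corollary6p10 (E : BipSepGraph.{u}) :
    BipSepGraph.IsDynSystem E.omegaSystem ∧
      ∀ (X : Type w) [TopologicalSpace X] (S : BipSepGraph.DynData E X),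
        BipSepGraph.IsDynSystem S →
          ∃! f : X → E.Omega, Continuous f ∧ BipSepGraph.IsEquivariant S E.omegaSystem f := by
  refine ⟨E.isDynSystem_omegaSystem, fun X _ S hS =>
    ⟨(BipSepGraph.HomeoSystem.ofDynData S hS).toOmega,
      ⟨BipSepGraph.HomeoSystem.continuous_toOmega _,
        BipSepGraph.HomeoSystem.isEquivariant_toOmega hS⟩, fun g hg => ?_⟩⟩
  exact (BipSepGraph.HomeoSystem.intertwines_of_isEquivariant hS hg.2).eq
    (BipSepGraph.HomeoSystem.intertwines_of_isEquivariant hS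
      (BipSepGraph.HomeoSystem.isEquivariant_toOmega hS))
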